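/- Let $-\infty<a<b\le\infty$ and let $f$ be a probability density on $\mathbb R$ that is positive on $(a,b)$, zero outside $(a,b)$, and $C^1$ on $(a,b)$ with $\int_a^b|f'(x)|\,dx<\infty$. Suppose $f(x)\to A_1$ as $x\to a+0$ and, if $b<\infty$, $f(x)\to A_2$ as $x\to b-0$; if $b=\infty$ put $A_2=0$. (The limits $A_1,A_2\ge 0$ may vanish.) Consider the location family $f_\theta(x)=f(x-\theta)$, $\theta\in\mathbb R$, and let $g(x)=|x|$. An estimator $\vec T=\{T_n\}$ is a sequence of measurable functions $T_n:\mathbb R^n\to\mathbb R$ of $n$ i.i.d. data. Put $$\beta(\vec T,\theta,\epsilon)=\liminf_{n\to\infty}\frac{-1}{n}\log f_\theta^n\{|T_n-\theta|\ge\epsilon\}\in[0,\infty],$$ $$\alpha_1(\theta)=\limsup_{\epsilon\to+0}\frac1{g(\epsilon)}\sup_{\vec T}\inf_{|\theta'-\theta|\le\epsilon}\beta(\vec T,\theta',\epsilon),\qquad \alpha_2(\theta)=\sup_{\vec T}\alpha_2(\vec T,\theta),\qquad \alpha_2(\vec T,\theta)=\liminf_{\epsilon\to+0}\frac1{g(\epsilon)}\inf_{|\theta'-\theta|\le\epsilon}\beta(\vec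 T,\theta',\epsilon).$$ With $I^s(p\|q)=-\log\int p^sq^{1-s}\,dx$, let $I^s_{g,\theta}=\lim_{\epsilon\to+0}I^s(f_{\theta-\epsilon/2}\|f_{\theta+\epsilon/2})/g(\epsilon)$ for $0<s<1$, and let $\kappa$ be defined by $x^\kappa=\lim_{\epsilon\to+0}g(x\epsilon)/g(\epsilon)$ for $x>0$. Put $\overline\alpha_1(\theta)=2^\kappa\sup_{0<s<1}I^s_{g,\theta}$. Let $\overline\alpha_2(\theta)=2I^{1/2}_{g,\theta}$ if $\kappa=1$; if $\kappa<1$ (respectively $\kappa>1$), let $\overline\alpha_2(\theta)$ be the supremum (respectively infimum) over $0<s<1$ of $\frac{I^s_{g,\theta}}{s(1-s)}\big(s^{1/(\kappa-1)}+(1-s)^{1/(\kappa-1)}\big)^{\kappa-1}$. Then $\kappa=1$, the limit $I^s_{g,\theta}$ exists, uniformly in $s\in(0,1)$, and equals $A_1s+A_2(1-s)$. For every $\theta\in\mathbb R$, $$\alpha_1(\theta)=\overline\alpha_1(\theta)=2\sup_{0<s<1}I^s_{g,\theta}=2\max\{A_1,A_2\},\qquad \alpha_2(\theta)=\overline\alpha_2(\theta)=2I^{1/2}_{g,\theta}=A_1+A_2.$$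 Therefore $\alpha_1(\theta)=\alpha_2(\theta)$ if and only if $A_1=A_2$. The bounds are attained, in the following sense. For each $\epsilon>0$ let $\vec T_\epsilon$ be the estimator $\min_ix_i-a-\epsilon$ if $A_1\ge A_2$, or $\max_ix_i-b+\epsilon$ if $b<\infty$ and $A_2\ge A_1$. In either case $$\lim_{\epsilon\to+0}\frac1{g(\epsilon)}\inf_{|\theta'-\theta|\le\epsilon}\beta(\vec T_\epsilon,\theta',\epsilon)=2\max\{A_1,A_2\}.$$ If $b<\infty$, then $\alpha_2(\vec T,\theta)=A_1+A_2$ for $T_n=\lambda(\min_ix_i-a)+(1-\lambda)(\max_ix_i-b)$ with $\lambda=A_1/(A_1+A_2)$ (any $\lambda\in[0,1]$ if $A_1=A_2=0$). If $b=\infty$, then $\alpha_2(\vec T,\theta)=A_1+A_2=A_1$ for $T_n=\min_ix_i-a$. -/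

import Mathlib

open Filter Topology MeasureTheory Set

namespace NonregularEstimation

noncomputable section

/-- The measure on the real line with Lebesgue density `p`. -/
def densityMeasure (p : ℝ → ℝ) : Measure ℝ :=
  volume.withDensity fun x => ENNReal.ofReal (p x)

/-- The location shift family generated by `f`: the member with parameter `θ` has the density
`x ↦ f (x - θ)`. -/
def locationFamily (f : ℝ → ℝ) (θ x : ℝ) : ℝ := f (x - θ)

/-- The relative Rényi entropy `I^s(p‖q) = -log ∫ p^s q^(1-s)` of two densities (`0 < s < 1`),
with the value `⊤` when the integral vanishes. -/
def renyi (s : ℝ) (p q : ℝ → ℝ) : EReal :=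
  -ENNReal.log (∫⁻ x, ENNReal.ofReal (p x ^ s * q x ^ (1 - s)))

/-- An estimator: for every sample size `n`, a measurable real function of the `n` data. -/
structure Estimator where
  toFun : ∀ n : ℕ, (Fin n → ℝ) → ℝ
  measurable_toFun : ∀ n, Measurable (toFun n)

/-- The first exponential rate
`β(T, θ, ε) = liminf_n (-1/n) log p_θ^n {|T_n - θ| ≥ ε}` of an estimator for the family of
densities `p θ`; it is `⊤` if the error probabilities eventually vanish. -/
def errorRate (p : ℝ → ℝ → ℝ) (T : Estimator) (θ ε : ℝ) : EReal :=
  liminf (fun n : ℕ =>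
    -ENNReal.log (Measure.pi (fun _ : Fin n => densityMeasure (p θ))
      {x | ε ≤ |T.toFun n x - θ|}) / (n : EReal)) atTop

/-- `inf_{θ-ε ≤ θ' ≤ θ+ε} β(T, θ', ε)`. -/
def worstRate (p : ℝ → ℝ → ℝ) (T : Estimator) (θ ε : ℝ) : EReal :=
  ⨅ θ' ∈ Icc (θ - ε) (θ + ε), errorRate p T θ' ε

/-- `α₁(θ) = limsup_{ε→+0} (1/g(ε)) sup_T inf_{θ-ε ≤ θ' ≤ θ+ε} β(T, θ', ε)`. -/
def alphaOne (g : ℝ → ℝ) (p : ℝ → ℝ → ℝ) (θ : ℝ) : EReal :=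
  limsup (fun ε : ℝ => (⨆ T : Estimator, worstRate p T θ ε) / ((g ε : ℝ) : EReal)) (𝓝[>] 0)

/-- `α₂(T, θ) = liminf_{ε→+0} (1/g(ε)) inf_{θ-ε ≤ θ' ≤ θ+ε} β(T, θ', ε)`. -/
def alphaTwoOf (g : ℝ → ℝ) (p : ℝ → ℝ → ℝ) (T : Estimator) (θ : ℝ) : EReal :=
  liminf (fun ε : ℝ => worstRate p T θ ε / ((g ε : ℝ) : EReal)) (𝓝[>] 0)

/-- `α₂(θ) = sup_T α₂(T, θ)`. -/
def alphaTwo (g : ℝ → ℝ) (p : ℝ → ℝ → ℝ) (θ : ℝ) : EReal :=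
  ⨆ T : Estimator, alphaTwoOf g p T θ

/-- `I^s(p_{θ-ε/2} ‖ p_{θ+ε/2}) / g(ε)`. -/
def renyiQuotient (g : ℝ → ℝ) (p : ℝ → ℝ → ℝ) (θ s ε : ℝ) : EReal :=
  renyi s (p (θ - ε / 2)) (p (θ + ε / 2)) / ((g ε : ℝ) : EReal)

/-- `I^s_{g,θ} = lim_{ε→+0} I^s(p_{θ-ε/2} ‖ p_{θ+ε/2}) / g(ε)`. It is written as an upper limit,
which is the limit whenever the limit exists. -/
def renyiLimit (g : ℝ → ℝ) (p : ℝ → ℝ → ℝ) (θ s : ℝ) : EReal :=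
  limsup (fun ε : ℝ => renyiQuotient g p θ s ε) (𝓝[>] 0)

/-- `κ` is the exponent of `g`: `x^κ = lim_{ε→+0} g(xε)/g(ε)` for all `x > 0`. -/
def IsScalingExponent (g : ℝ → ℝ) (κ : ℝ) : Prop :=
  ∀ x : ℝ, 0 < x → Tendsto (fun ε : ℝ => g (x * ε) / g ε) (𝓝[>] 0) (𝓝 (x ^ κ))

/-- `ᾱ₁(θ) = 2^κ sup_{0<s<1} I^s_{g,θ}`, where `κ` is the exponent of `g`. -/
def alphaBarOne (g : ℝ → ℝ) (κ : ℝ) (p : ℝ → ℝ → ℝ) (θ : ℝ) : EReal :=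
  (((2 : ℝ) ^ κ : ℝ) : EReal) * ⨆ s ∈ Ioo (0 : ℝ) 1, renyiLimit g p θ s

/-- `(I^s_{g,θ} / (s(1-s))) (s^{1/(κ-1)} + (1-s)^{1/(κ-1)})^{κ-1}`. -/
def weightedRenyiLimit (g : ℝ → ℝ) (κ : ℝ) (p : ℝ → ℝ → ℝ) (θ s : ℝ) : EReal :=
  (((s ^ (1 / (κ - 1)) + (1 - s) ^ (1 / (κ - 1))) ^ (κ - 1) / (s * (1 - s)) : ℝ) : EReal) *
    renyiLimit g p θ s

/-- `ᾱ₂(θ)`: the supremum over `0 < s < 1` of the weighted limits if `κ < 1`, their infimum if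
`κ > 1`, and `2 I^{1/2}_{g,θ}` if `κ = 1`, where `κ` is the exponent of `g`. -/
def alphaBarTwo (g : ℝ → ℝ) (κ : ℝ) (p : ℝ → ℝ → ℝ) (θ : ℝ) : EReal :=
  if κ < 1 then ⨆ s ∈ Ioo (0 : ℝ) 1, weightedRenyiLimit g κ p θ s
  else if κ = 1 then 2 * renyiLimit g p θ (1 / 2)
  else ⨅ s ∈ Ioo (0 : ℝ) 1, weightedRenyiLimit g κ p θ s

/-- The estimator `min_i x_i - c`. -/
def minEstimator (c : ℝ) : Estimator where
  toFun _ x := (⨅ i, x i) - c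
  measurable_toFun _ := (Measurable.iInf fun i => measurable_pi_apply i).sub_const c

/-- The estimator `max_i x_i - c`. -/
def maxEstimator (c : ℝ) : Estimator where
  toFun _ x := (⨆ i, x i) - c
  measurable_toFun _ := (Measurable.iSup fun i => measurable_pi_apply i).sub_const c

/-- The convex combination `l (min_i x_i - a) + (1 - l) (max_i x_i - b)`. -/
def convexEstimator (a b l : ℝ) : Estimator where
  toFun n x := l * (minEstimator a).toFun n x + (1 - l) * (maxEstimator b).toFun n x
  measurable_toFun n :=
    (((minEstimator a).measurable_toFun n).const_mul l).add
      (((maxEstimator b).measurable_toFun n).const_mul (1 - l))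

/-- `f` is a probability density on the real line that is positive exactly on the open set `S`
and continuously differentiable there, with `f'` integrable over `S`. -/
structure IsSmoothPdfOn (f : ℝ → ℝ) (S : Set ℝ) : Prop where
  pos : ∀ x ∈ S, 0 < f x
  zero : ∀ x ∉ S, f x = 0
  integral_eq_one : ∫ x, f x = 1
  contDiffOn : ContDiffOn ℝ 1 f S
  integrableOn_deriv : IntegrableOn (deriv f) S

end

end NonregularEstimation

open NonregularEstimation

open NonregularEstimation

/-! Only the jumps of `f` at the end points matter to first order. A shift by a small t removes mass
about A₁t at the left end or A₂t at the right end (`HasEdgeSlopes`), while the change of shape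
inside the support contributes only o(t) to the affinities ∫ f(y+t)^s f(y)^(1-s) dy.

For the interior, weighted AM-GM loses at most (u-v)²/max(u,v). One factor |u-v| is bounded by the
integral of |f'| over an interval of length t. The other, the relative change |u-v|/max(u,v), is at
most 1 and tends to 0 at each point of the support. Tonelli and dominated convergence with majorant
|f'| give o(t) (`tendsto_meanGap_div`). So the affinity is 1 - (A₁s + A₂(1-s))t + o(t), uniformly in
s (`eventually_shiftAffinity_linear`), which gives the Rényi limits.

For the upper bounds on the rates, take θ₂ - θ₁ = d = ε₁ + ε₂. The two error events cover the sample
space, so one of them carries half of the product measure with density √(f_θ₁ f_θ₂), whose mass per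
coordinate is about exp(-(A₁+A₂)d/2). Cauchy-Schwarz turns this into a lower bound on the error
probability at that parameter. The decisive refinement is to keep of the other density only its part
on the common support: the factor exp(-A₂d) or exp(-A₁d) so gained lowers the exponent A₁+A₂ to A₁
at θ₁, or to A₂ at θ₂ (`eventually_errorRate_le_or`).

Equal radii give 2 max(A₁, A₂). If a single estimator must serve all radii, ε₁ and ε₂ may be chosen
in proportion to the two slopes, which gives A₁ + A₂ (`alphaTwoOf_le`).

Conversely, an error of an extreme-value estimator forces all the data away from one end, an event
whose probability is an n-th power (`le_errorRate`). Centring the minimum by ε makes all errors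
one-sided, at distance 2ε from the end. The weight A₁/(A₁+A₂) equalises the two error exponents of
the convex combination. -/

namespace NonregularEstimation

open scoped ENNReal

/-! ### Product densities and Cauchy-Schwarz -/

/-- Tonelli's theorem for a product of functions of one coordinate each. -/
theorem lintegral_fin_prod_eq_prod {n : ℕ} (f : Fin n → ℝ → ℝ≥0∞) (hf : ∀ i, Measurable (f i)) :
    ∫⁻ x : Fin n → ℝ, ∏ i, f i (x i) = ∏ i, ∫⁻ x, f i x := by
  induction n with
  | zero => simp [volume_pi]
  | succ n ih =>
    have hmp :=
      measurePreserving_piFinSuccAbove (fun _ : Fin (n + 1) => (volume : Measure ℝ)) 0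
    rw [volume_pi, ← hmp.symm.lintegral_comp (by fun_prop)]
    simp only [MeasurableEquiv.piFinSuccAbove_symm_apply, Fin.prod_univ_succ, Fin.insertNthEquiv,
      Equiv.coe_fn_mk, Fin.insertNth_zero', Fin.cons_zero, Fin.cons_succ]
    rw [lintegral_prod_mul (f := f 0) (g := fun y : Fin n → ℝ => ∏ i, f i.succ (y i))
      (hf 0).aemeasurable (Finset.measurable_prod _ fun i _ =>
        (hf i.succ).comp (measurable_pi_apply i)).aemeasurable, ← ih _ fun i => hf i.succ, volume_pi]

/-- The product of measures with densities has the product density. -/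
theorem pi_withDensity_eq {n : ℕ} {u : ℝ → ℝ≥0∞} (hu : Measurable u)
    [SigmaFinite (volume.withDensity u)] :
    Measure.pi (fun _ : Fin n => volume.withDensity u)
      = (volume : Measure (Fin n → ℝ)).withDensity fun x => ∏ i, u (x i) := by
  refine Measure.pi_eq fun s hs => ?_
  rw [withDensity_apply _ (MeasurableSet.univ_pi hs), ← lintegral_indicator (.univ_pi hs)]
  have h : ((univ.pi s).indicator fun x : Fin n → ℝ => ∏ i, u (x i))
      = fun x => ∏ i, (s i).indicator u (x i) := by
    classical
    funext x
    by_cases hx : x ∈ univ.pi s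
    · rw [indicator_of_mem hx]
      exact Finset.prod_congr rfl fun i _ => (indicator_of_mem (hx i (mem_univ i)) u).symm
    · rw [indicator_of_notMem hx]
      obtain ⟨i, hi⟩ : ∃ i, x i ∉ s i := by simpa [Set.mem_pi] using hx
      exact (Finset.prod_eq_zero (Finset.mem_univ i) (indicator_of_notMem hi u)).symm
  rw [h, lintegral_fin_prod_eq_prod _ fun i => hu.indicator (hs i)]
  refine Finset.prod_congr rfl fun i _ => ?_
  rw [lintegral_indicator (hs i), withDensity_apply _ (hs i)]

/-- Cauchy-Schwarz for the product of `n` copies of the measure with density `(u v)^(1/2)`. -/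
theorem pi_withDensity_sqrt_sq_le {n : ℕ} {u v : ℝ → ℝ≥0∞} (hu : Measurable u) (hv : Measurable v)
    [IsFiniteMeasure (volume.withDensity u)] [IsFiniteMeasure (volume.withDensity v)]
    [IsFiniteMeasure (volume.withDensity fun x => u x ^ (1 / 2 : ℝ) * v x ^ (1 / 2 : ℝ))]
    {E : Set (Fin n → ℝ)} (hE : MeasurableSet E) :
    Measure.pi (fun _ : Fin n =>
        volume.withDensity fun x => u x ^ (1 / 2 : ℝ) * v x ^ (1 / 2 : ℝ)) E ^ 2
      ≤ Measure.pi (fun _ : Fin n => volume.withDensity u) E * (∫⁻ x, v x) ^ n := by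
  have h2 : (2 : ℝ).HolderConjugate 2 := ⟨by norm_num, by norm_num, by norm_num⟩
  have hpow : ∀ x : ℝ≥0∞, (x ^ (1 / 2 : ℝ)) ^ (2 : ℝ) = x := fun x => by
    rw [← ENNReal.rpow_mul]; norm_num
  have hvn : (∫⁻ x, v x) ^ n
      = Measure.pi (fun _ : Fin n => volume.withDensity v) univ := by
    rw [Measure.pi_univ]; simp
  rw [hvn, pi_withDensity_eq hu, pi_withDensity_eq hv, pi_withDensity_eq (by fun_prop),
    withDensity_apply _ hE, withDensity_apply _ hE, withDensity_apply _ .univ,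
    Measure.restrict_univ]
  set F : (Fin n → ℝ) → ℝ≥0∞ := fun x => (∏ i, u (x i)) ^ (1 / 2 : ℝ)
  set G : (Fin n → ℝ) → ℝ≥0∞ := fun x => (∏ i, v (x i)) ^ (1 / 2 : ℝ)
  have hFG : ∀ x : Fin n → ℝ,
      ∏ i, (u (x i) ^ (1 / 2 : ℝ) * v (x i) ^ (1 / 2 : ℝ)) = (F * G) x := fun x => by
    simp only [F, G, Pi.mul_apply, Finset.prod_mul_distrib]
    rw [ENNReal.prod_rpow_of_nonneg (by norm_num), ENNReal.prod_rpow_of_nonneg (by norm_num)]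
  simp_rw [hFG]
  have hle := ENNReal.lintegral_mul_le_Lp_mul_Lq (volume.restrict E) h2 (f := F) (g := G)
    (by fun_prop) (by fun_prop)
  simp only [F, G, hpow] at hle
  calc (∫⁻ x in E, (F * G) x) ^ 2
      ≤ ((∫⁻ x in E, ∏ i, u (x i)) ^ (1 / 2 : ℝ) * (∫⁻ x in E, ∏ i, v (x i)) ^ (1 / 2 : ℝ)) ^ 2 :=
        pow_le_pow_left₀ zero_le hle 2
    _ = (∫⁻ x in E, ∏ i, u (x i)) * ∫⁻ x in E, ∏ i, v (x i) := by
        rw [mul_pow, ← ENNReal.rpow_natCast, ← ENNReal.rpow_natCast]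
        simp only [Nat.cast_ofNat, hpow]
    _ ≤ _ := by gcongr; exact Measure.restrict_le_self

/-! ### From error probabilities to exponential rates -/

/-- An exponential upper bound on the error probabilities bounds the exponential rate below. -/
theorem le_liminf_rate {P : ℕ → ℝ≥0∞} {r : ℝ}
    (h : ∀ᶠ n in atTop, P n ≤ 2 * ENNReal.ofReal (Real.exp (-r)) ^ n) :
    (r : EReal) ≤ liminf (fun n : ℕ => -ENNReal.log (P n) / (n : EReal)) atTop := by
  refine EReal.ge_of_forall_gt_iff_ge.mp fun z hz => ?_
  have hz : z < r := by exact_mod_cast hz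
  -- The prefactor 2 costs log 2 / n in the rate, which vanishes in the limit.
  have h1 : Tendsto (fun n : ℕ => r - Real.log 2 / n) atTop (𝓝 (r - 0)) :=
    tendsto_const_nhds.sub (tendsto_const_div_atTop_nhds_zero_nat _)
  rw [sub_zero] at h1
  refine le_liminf_of_le (by isBoundedDefault) ?_
  filter_upwards [h, h1.eventually (lt_mem_nhds hz), eventually_gt_atTop 0] with n hn hn1 hn0
  have hn0' : (0 : ℝ) < n := by exact_mod_cast hn0
  have hc : ((n : ℕ) : EReal) = ((n : ℝ) : EReal) := by simp
  rw [hc, EReal.le_div_iff_mul_le (by exact_mod_cast hn0') (EReal.coe_ne_top _)]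
  have h2 : (2 : ℝ≥0∞) * ENNReal.ofReal (Real.exp (-r)) ^ n
      = ENNReal.ofReal (Real.exp (Real.log 2 - n * r)) := by
    rw [Real.exp_sub, Real.exp_log two_pos, ← ENNReal.ofReal_pow (Real.exp_pos _).le,
      ← Real.exp_nat_mul, div_eq_mul_inv, ← Real.exp_neg, ENNReal.ofReal_mul two_pos.le]
    simp
  have h3 := ENNReal.log_le_log (hn.trans_eq h2)
  rw [ENNReal.log_ofReal_of_pos (Real.exp_pos _), Real.log_exp] at h3
  refine le_trans ?_ (EReal.neg_le_neg_iff.mpr h3)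
  rw [← EReal.coe_neg, ← EReal.coe_mul, EReal.coe_le_coe_iff]
  have : Real.log 2 / n * n = Real.log 2 := by field_simp
  nlinarith

/-- An exponential lower bound on infinitely many of the error probabilities bounds the
exponential rate above. -/
theorem liminf_rate_le {P : ℕ → ℝ≥0∞} {r : ℝ}
    (h : ∃ᶠ n in atTop, ENNReal.ofReal (Real.exp (-r)) ^ n ≤ 4 * P n) :
    liminf (fun n : ℕ => -ENNReal.log (P n) / (n : EReal)) atTop ≤ (r : EReal) := by
  refine EReal.le_of_forall_lt_iff_le.mp fun z hz => ?_
  have hz : r < z := by exact_mod_cast hz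
  have h1 : Tendsto (fun n : ℕ => r + Real.log 4 / n) atTop (𝓝 (r + 0)) :=
    tendsto_const_nhds.add (tendsto_const_div_atTop_nhds_zero_nat _)
  rw [add_zero] at h1
  refine liminf_le_of_frequently_le ?_ (by isBoundedDefault)
  refine (h.and_eventually ((h1.eventually (gt_mem_nhds hz)).and (eventually_gt_atTop 0))).mono ?_
  rintro n ⟨hn, hn1, hn0⟩
  have hn0' : (0 : ℝ) < n := by exact_mod_cast hn0
  have hc : ((n : ℕ) : EReal) = ((n : ℝ) : EReal) := by simp
  rw [hc, EReal.div_le_iff_le_mul (by exact_mod_cast hn0') (EReal.coe_ne_top _)]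
  have h2 : ENNReal.ofReal (Real.exp (-r)) ^ n
      = 4 * ENNReal.ofReal (Real.exp (-(n * r) - Real.log 4)) := by
    rw [Real.exp_sub, Real.exp_log (by norm_num), ← ENNReal.ofReal_pow (Real.exp_pos _).le,
      ← Real.exp_nat_mul, ← ENNReal.ofReal_ofNat 4, ← ENNReal.ofReal_mul (by norm_num)]
    congr 1
    rw [mul_neg]; ring
  rw [h2, ENNReal.mul_le_mul_iff_right (by norm_num) (by norm_num)] at hn
  have h3 := ENNReal.log_le_log hn
  rw [ENNReal.log_ofReal_of_pos (Real.exp_pos _), Real.log_exp] at h3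
  refine (EReal.neg_le_neg_iff.mpr h3).trans ?_
  rw [← EReal.coe_neg, ← EReal.coe_mul, EReal.coe_le_coe_iff]
  have : Real.log 4 / n * n = Real.log 4 := by field_simp
  nlinarith

/-! ### Basic properties of the density and its shifts -/

namespace IsSmoothPdfOn

variable {f : ℝ → ℝ} {S : Set ℝ}

theorem nonneg (hf : IsSmoothPdfOn f S) (x : ℝ) : 0 ≤ f x := by
  by_cases hx : x ∈ S
  · exact (hf.pos x hx).le
  · exact (hf.zero x hx).ge

theorem integrable (hf : IsSmoothPdfOn f S) : Integrable f := by
  by_contra h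
  have := hf.integral_eq_one
  rw [integral_undef h] at this
  exact zero_ne_one this

theorem measurable (hf : IsSmoothPdfOn f S) (hS : IsOpen S) : Measurable f := by
  classical
  have h : f = S.piecewise f (fun _ => 0) := by
    funext x
    by_cases hx : x ∈ S
    · rw [piecewise_eq_of_mem _ _ _ hx]
    · rw [piecewise_eq_of_notMem _ _ _ hx, hf.zero x hx]
  rw [h]
  exact hf.contDiffOn.continuousOn.measurable_piecewise continuousOn_const hS.measurableSet

theorem lintegral_eq_one (hf : IsSmoothPdfOn f S) : ∫⁻ x, ENNReal.ofReal (f x) = 1 := by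
  rw [← ofReal_integral_eq_lintegral_ofReal hf.integrable (.of_forall hf.nonneg),
    hf.integral_eq_one, ENNReal.ofReal_one]

theorem isProbabilityMeasure_densityMeasure (hf : IsSmoothPdfOn f S) :
    IsProbabilityMeasure (densityMeasure f) :=
  ⟨by rw [densityMeasure, withDensity_apply _ .univ, Measure.restrict_univ, hf.lintegral_eq_one]⟩

theorem isProbabilityMeasure_locationFamily (hf : IsSmoothPdfOn f S) (θ : ℝ) :
    IsProbabilityMeasure (densityMeasure (locationFamily f θ)) :=
  ⟨by
    rw [densityMeasure, withDensity_apply _ .univ, Measure.restrict_univ, ← hf.lintegral_eq_one]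
    exact lintegral_sub_right_eq_self (fun x => ENNReal.ofReal (f x)) θ⟩

/-- The shifted density gives a shifted set the same mass. -/
theorem densityMeasure_locationFamily_apply (θ : ℝ) {B : Set ℝ} (hB : MeasurableSet B) :
    densityMeasure (locationFamily f θ) ((fun x => x - θ) ⁻¹' B) = densityMeasure f B := by
  have hB' : MeasurableSet ((fun x : ℝ => x - θ) ⁻¹' B) := (measurable_id.sub_const θ) hB
  rw [densityMeasure, densityMeasure, withDensity_apply _ hB, withDensity_apply _ hB',
    ← lintegral_indicator hB, ← lintegral_indicator hB',
    ← lintegral_sub_right_eq_self (B.indicator fun x => ENNReal.ofReal (f x)) θ]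
  rfl

theorem ae_mem (hf : IsSmoothPdfOn f S) (hS : IsOpen S) : ∀ᵐ x ∂densityMeasure f, x ∈ S := by
  rw [ae_iff]
  change densityMeasure f Sᶜ = 0
  rw [densityMeasure, withDensity_apply _ hS.measurableSet.compl,
    setLIntegral_congr_fun (g := fun _ => 0) hS.measurableSet.compl fun x hx => by
      simp [hf.zero x hx]]
  simp

theorem ae_mem_locationFamily (hf : IsSmoothPdfOn f S) (hS : IsOpen S) (θ : ℝ) :
    ∀ᵐ x ∂densityMeasure (locationFamily f θ), x - θ ∈ S :=
  ((densityMeasure_locationFamily_apply θ hS.measurableSet.compl).trans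
    (hf.ae_mem hS) : _ = (0 : ℝ≥0∞))

end IsSmoothPdfOn

/-! ### Mass near the end points -/

variable {f : ℝ → ℝ} {S : Set ℝ} {A A₁ A₂ : ℝ}

theorem densityMeasure_le_of_forall_le {B : Set ℝ} (hB : MeasurableSet B) {c t : ℝ} (ht : 0 ≤ t)
    (hBt : volume B = ENNReal.ofReal t) (h : ∀ x ∈ B, f x ≤ c) :
    densityMeasure f B ≤ ENNReal.ofReal (c * t) := by
  rw [densityMeasure, withDensity_apply _ hB, ENNReal.ofReal_mul' ht, ← hBt, ← setLIntegral_const]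
  exact setLIntegral_mono' hB fun x hx => ENNReal.ofReal_le_ofReal (h x hx)

theorem le_densityMeasure_of_forall_le {B : Set ℝ} (hB : MeasurableSet B) {c t : ℝ} (ht : 0 ≤ t)
    (hBt : volume B = ENNReal.ofReal t) (h : ∀ x ∈ B, c ≤ f x) :
    ENNReal.ofReal (c * t) ≤ densityMeasure f B := by
  rw [densityMeasure, withDensity_apply _ hB, ENNReal.ofReal_mul' ht, ← hBt, ← setLIntegral_const]
  exact setLIntegral_mono' hB fun x hx => ENNReal.ofReal_le_ofReal (h x hx)

/-- The mass near a left end point at which the density has the limit `A`. -/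
theorem eventually_densityMeasure_left {a : ℝ} (hA : Tendsto f (𝓝[>] a) (𝓝 A)) {δ : ℝ}
    (hδ : 0 < δ) :
    ∀ᶠ t in 𝓝[>] (0 : ℝ), ENNReal.ofReal ((A - δ) * t) ≤ densityMeasure f (Ioo a (a + t)) ∧
      densityMeasure f (Ioc a (a + t)) ≤ ENNReal.ofReal ((A + δ) * t) := by
  obtain ⟨c, hc, hac⟩ := mem_nhdsGT_iff_exists_Ioo_subset.mp
    (hA (Ioo_mem_nhds (sub_lt_self A hδ) (lt_add_of_pos_right A hδ)))
  filter_upwards [Ioo_mem_nhdsGT (sub_pos.mpr hc)] with t ht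
  have hsub : ∀ x ∈ Ioc a (a + t), A - δ < f x ∧ f x < A + δ := fun x hx =>
    hac ⟨hx.1, hx.2.trans_lt (by linarith [ht.2])⟩
  refine ⟨le_densityMeasure_of_forall_le measurableSet_Ioo ht.1.le ?_ fun x hx =>
    (hsub x (Ioo_subset_Ioc_self hx)).1.le,
    densityMeasure_le_of_forall_le measurableSet_Ioc ht.1.le ?_ fun x hx => (hsub x hx).2.le⟩
  · rw [Real.volume_Ioo, add_sub_cancel_left]
  · rw [Real.volume_Ioc, add_sub_cancel_left]

/-- The mass near a right end point at which the density has the limit `A`. -/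
theorem eventually_densityMeasure_right {b : ℝ} (hA : Tendsto f (𝓝[<] b) (𝓝 A)) {δ : ℝ}
    (hδ : 0 < δ) :
    ∀ᶠ t in 𝓝[>] (0 : ℝ), ENNReal.ofReal ((A - δ) * t) ≤ densityMeasure f (Ioo (b - t) b) ∧
      densityMeasure f (Ico (b - t) b) ≤ ENNReal.ofReal ((A + δ) * t) := by
  obtain ⟨c, hc, hac⟩ := mem_nhdsLT_iff_exists_Ioo_subset.mp
    (hA (Ioo_mem_nhds (sub_lt_self A hδ) (lt_add_of_pos_right A hδ)))
  filter_upwards [Ioo_mem_nhdsGT (sub_pos.mpr hc)] with t ht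
  have hsub : ∀ x ∈ Ico (b - t) b, A - δ < f x ∧ f x < A + δ := fun x hx =>
    hac ⟨lt_of_lt_of_le (by linarith [ht.2]) hx.1, hx.2⟩
  refine ⟨le_densityMeasure_of_forall_le measurableSet_Ioo ht.1.le ?_ fun x hx =>
    (hsub x (Ioo_subset_Ico_self hx)).1.le,
    densityMeasure_le_of_forall_le measurableSet_Ico ht.1.le ?_ fun x hx => (hsub x hx).2.le⟩
  · rw [Real.volume_Ioo, sub_sub_cancel]
  · rw [Real.volume_Ico, sub_sub_cancel]

/-- If `C` is almost surely the complement of `B`, bounds for the mass of `B` give bounds for the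
mass of `C`. -/
theorem measure_le_one_sub {μ : Measure ℝ} [IsProbabilityMeasure μ] {B C : Set ℝ}
    (hB : MeasurableSet B) (hCB : ∀ᵐ x ∂μ, x ∈ C → x ∉ B) {m : ℝ}
    (hm : ENNReal.ofReal m ≤ μ B) : μ C ≤ ENNReal.ofReal (1 - m) := by
  calc μ C ≤ μ Bᶜ := measure_mono_ae hCB
    _ = 1 - μ B := prob_compl_eq_one_sub hB
    _ ≤ 1 - ENNReal.ofReal m := tsub_le_tsub_left hm 1
    _ ≤ ENNReal.ofReal (1 - m) := by
      rw [tsub_le_iff_right, ← ENNReal.ofReal_one]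
      exact (ENNReal.ofReal_le_ofReal (by linarith)).trans (ENNReal.ofReal_add_le (p := 1 - m))

theorem one_sub_le_measure {μ : Measure ℝ} [IsProbabilityMeasure μ] {B C : Set ℝ}
    (hB : MeasurableSet B) (hCB : ∀ᵐ x ∂μ, x ∉ B → x ∈ C) {m : ℝ} (h0 : 0 ≤ m)
    (hm : μ B ≤ ENNReal.ofReal m) : ENNReal.ofReal (1 - m) ≤ μ C := by
  calc ENNReal.ofReal (1 - m) = 1 - ENNReal.ofReal m := by
        rw [ENNReal.ofReal_sub _ h0, ENNReal.ofReal_one]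
    _ ≤ 1 - μ B := tsub_le_tsub_left hm 1
    _ = μ Bᶜ := (prob_compl_eq_one_sub hB).symm
    _ ≤ μ C := measure_mono_ae hCB

/-- The mass that a density on `S` loses at the two ends when `S` is shifted to the right or to
the left by a small amount is linear in the shift, with the slopes `A₁` and `A₂`. -/
structure HasEdgeSlopes (f : ℝ → ℝ) (S : Set ℝ) (A₁ A₂ : ℝ) : Prop where
  left_nonneg : 0 ≤ A₁
  right_nonneg : 0 ≤ A₂
  left : ∀ δ : ℝ, 0 < δ → ∀ᶠ t in 𝓝[>] (0 : ℝ),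
    ENNReal.ofReal (1 - (A₁ + δ) * t) ≤ densityMeasure f {z | z - t ∈ S} ∧
      densityMeasure f {z | z - t ∈ S} ≤ ENNReal.ofReal (1 - (A₁ - δ) * t)
  right : ∀ δ : ℝ, 0 < δ → ∀ᶠ t in 𝓝[>] (0 : ℝ),
    ENNReal.ofReal (1 - (A₂ + δ) * t) ≤ densityMeasure f {z | z + t ∈ S} ∧
      densityMeasure f {z | z + t ∈ S} ≤ ENNReal.ofReal (1 - (A₂ - δ) * t)

/-- The mass lost is that of a boundary strip of width t. Its open and half-open versions give the
two bounds, so no discussion of the boundary point is needed. -/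
theorem IsSmoothPdfOn.hasEdgeSlopes_Ioo {a b A₁ A₂ : ℝ} (hf : IsSmoothPdfOn f (Ioo a b))
    (hA₁ : Tendsto f (𝓝[>] a) (𝓝 A₁)) (hA₂ : Tendsto f (𝓝[<] b) (𝓝 A₂)) :
    HasEdgeSlopes f (Ioo a b) A₁ A₂ := by
  have := hf.isProbabilityMeasure_densityMeasure
  have hA₁0 : 0 ≤ A₁ := ge_of_tendsto' hA₁ hf.nonneg
  have hA₂0 : 0 ≤ A₂ := ge_of_tendsto' hA₂ hf.nonneg
  refine ⟨hA₁0, hA₂0, fun δ hδ => ?_, fun δ hδ => ?_⟩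
  · filter_upwards [eventually_densityMeasure_left hA₁ hδ, self_mem_nhdsWithin] with t ht ht0
    have ht0 : 0 < t := ht0
    refine ⟨one_sub_le_measure measurableSet_Ioc ?_ (by positivity) ht.2,
      measure_le_one_sub measurableSet_Ioo ?_ ht.1⟩
    · filter_upwards [hf.ae_mem isOpen_Ioo] with x hx hxB
      by_contra hc
      simp only [mem_Ioo, mem_Ioc, not_and_or, not_lt, not_le] at *
      grind
    · filter_upwards with x hx hxB
      simp only [mem_Ioo] at *
      linarith
  · filter_upwards [eventually_densityMeasure_right hA₂ hδ, self_mem_nhdsWithin] with t ht ht0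
    have ht0 : 0 < t := ht0
    refine ⟨one_sub_le_measure measurableSet_Ico ?_ (by positivity) ht.2,
      measure_le_one_sub measurableSet_Ioo ?_ ht.1⟩
    · filter_upwards [hf.ae_mem isOpen_Ioo] with x hx hxB
      by_contra hc
      simp only [mem_Ioo, mem_Ico, not_and_or, not_lt, not_le] at *
      grind
    · filter_upwards with x hx hxB
      simp only [mem_Ioo] at *
      linarith

/-- A half line has no right end: z > a implies z + t > a, so nothing is lost on that side and the
slope is 0. -/
theorem IsSmoothPdfOn.hasEdgeSlopes_Ioi {a A₁ : ℝ} (hf : IsSmoothPdfOn f (Ioi a))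
    (hA₁ : Tendsto f (𝓝[>] a) (𝓝 A₁)) : HasEdgeSlopes f (Ioi a) A₁ 0 := by
  have := hf.isProbabilityMeasure_densityMeasure
  have hA₁0 : 0 ≤ A₁ := ge_of_tendsto' hA₁ hf.nonneg
  refine ⟨hA₁0, le_rfl, fun δ hδ => ?_, fun δ hδ => ?_⟩
  · filter_upwards [eventually_densityMeasure_left hA₁ hδ, self_mem_nhdsWithin] with t ht ht0
    have ht0 : 0 < t := ht0
    refine ⟨one_sub_le_measure measurableSet_Ioc ?_ (by positivity) ht.2,
      measure_le_one_sub measurableSet_Ioo ?_ ht.1⟩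
    · filter_upwards [hf.ae_mem isOpen_Ioi] with x hx hxB
      by_contra hc
      simp only [mem_Ioi, mem_Ioc, not_and_or, not_lt, not_le] at *
      grind
    · filter_upwards with x hx hxB
      simp only [mem_Ioo, mem_Ioi] at *
      linarith
  · filter_upwards [self_mem_nhdsWithin] with t ht0
    have ht0 : 0 < t := ht0
    refine ⟨one_sub_le_measure (B := ∅) .empty ?_ (by positivity) (by simp), ?_⟩
    · filter_upwards [hf.ae_mem isOpen_Ioi] with x hx hxB
      simp only [mem_Ioi] at *
      linarith
    · refine prob_le_one.trans ?_
      rw [← ENNReal.ofReal_one]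
      exact ENNReal.ofReal_le_ofReal (by nlinarith)

/-! ### The gap between the means is o(t) -/

/-- The weighted arithmetic mean exceeds the weighted geometric mean by a quadratic term at
most. -/
theorem weighted_arith_mean_le {u v s : ℝ} (hu : 0 < u) (hv : 0 < v) (hs : s ∈ Ioo (0 : ℝ) 1) :
    s * u + (1 - s) * v ≤ u ^ s * v ^ (1 - s) + (u - v) ^ 2 / max u v := by
  have hs0 := hs.1
  have hs1 : 0 < 1 - s := sub_pos.mpr hs.2
  have hD : 0 < s * v + (1 - s) * u := by positivity
  have hm : 0 < max u v := lt_max_of_lt_left hu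
  -- the geometric mean dominates the harmonic mean
  have h1 : u * v / (s * v + (1 - s) * u) ≤ u ^ s * v ^ (1 - s) := by
    have h := Real.geom_mean_le_arith_mean2_weighted hs0.le hs1.le hv.le hu.le (by ring)
    have h' : (u ^ s * v ^ (1 - s)) * (v ^ s * u ^ (1 - s)) = u * v := by
      have e1 : u ^ s * u ^ (1 - s) = u := by
        rw [← Real.rpow_add hu, add_sub_cancel, Real.rpow_one]
      have e2 : v ^ s * v ^ (1 - s) = v := by
        rw [← Real.rpow_add hv, add_sub_cancel, Real.rpow_one]
      calc _ = (u ^ s * u ^ (1 - s)) * (v ^ s * v ^ (1 - s)) := by ring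
        _ = u * v := by rw [e1, e2]
    rw [div_le_iff₀ hD, ← h']
    gcongr
  -- Exact difference between the arithmetic mean and the harmonic bound, from (su + (1-s)v)(sv +
  -- (1-s)u) = uv + s(1-s)(u-v)².
  have h2 : s * u + (1 - s) * v
      = u * v / (s * v + (1 - s) * u) + s * (1 - s) * (u - v) ^ 2 / (s * v + (1 - s) * u) := by
    field_simp
    ring
  have h3 : s * (1 - s) * (u - v) ^ 2 / (s * v + (1 - s) * u) ≤ (u - v) ^ 2 / max u v := by
    rw [div_le_div_iff₀ hD hm]
    have h4 : s * (1 - s) * max u v ≤ s * v + (1 - s) * u := by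
      rcases le_total u v with h | h
      · rw [max_eq_right h]; nlinarith [mul_pos hs0 hv, mul_pos hs1 hu]
      · rw [max_eq_left h]; nlinarith [mul_pos hs0 hv, mul_pos hs1 hu]
    nlinarith [mul_le_mul_of_nonneg_right h4 (sq_nonneg (u - v))]
  linarith

/-- The relative change of `f` over `[y, y + t]`. -/
noncomputable def relChange (f : ℝ → ℝ) (t y : ℝ) : ℝ≥0∞ :=
  ENNReal.ofReal (|f (y + t) - f y| / max (f (y + t)) (f y))

/-- The points that stay in `S` when they are shifted by `t`. -/
def overlap (S : Set ℝ) (t : ℝ) : Set ℝ := {y | y ∈ S ∧ y + t ∈ S}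

/-- The integral of the quadratic gap between the arithmetic and the geometric means of the
density and its shift. -/
noncomputable def meanGap (f : ℝ → ℝ) (S : Set ℝ) (t : ℝ) : ℝ≥0∞ :=
  ∫⁻ y in overlap S t, ENNReal.ofReal ((f (y + t) - f y) ^ 2 / max (f (y + t)) (f y))

theorem measurableSet_overlap (hS : IsOpen S) (t : ℝ) : MeasurableSet (overlap S t) :=
  hS.measurableSet.inter ((measurable_id.add_const t) hS.measurableSet)

theorem measurable_relChange (hf : Measurable f) (t : ℝ) : Measurable (relChange f t) := by
  unfold relChange
  fun_prop

/-- For nonnegative u and v, |u - v| ≤ max u v. This is what makes |f'| an integrable majorant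
later. -/
theorem relChange_le_one (hf : IsSmoothPdfOn f S) (t y : ℝ) : relChange f t y ≤ 1 := by
  refine ENNReal.ofReal_le_one.mpr (div_le_one_of_le₀ ?_ ?_)
  · have h1 := hf.nonneg y
    have h2 := hf.nonneg (y + t)
    rw [abs_le]
    constructor <;> [have := le_max_right (f (y + t)) (f y); have := le_max_left (f (y + t)) (f y)]
      <;> linarith
  · exact (hf.nonneg y).trans (le_max_right _ _)

/-- Of the two factors in the squared increment only one is replaced by ∫ |f'| over [y, y+t]; the
other stays in the relative change. Tonelli then exchanges the condition y ≤ x ≤ y+t for x-t ≤ y ≤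
x. -/
theorem meanGap_le (hf : IsSmoothPdfOn f S) (hS : IsOpen S) (hS' : S.OrdConnected) {t : ℝ}
    (ht : 0 < t) :
    meanGap f S t ≤ ∫⁻ x in S, ‖deriv f x‖ₑ * ∫⁻ y in Icc (x - t) x, relChange f t y := by
  have hfm := hf.measurable hS
  have hr := measurable_relChange hfm t
  have hd : Measurable fun x => ‖deriv f x‖ₑ := (measurable_deriv f).enorm
  set T : Set (ℝ × ℝ) := {p | p.1 - t ≤ p.2} ∩ ({p | p.2 ≤ p.1} ∩ Prod.fst ⁻¹' S) with hT
  have hTm : MeasurableSet T := by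
    refine (measurableSet_le (measurable_fst.sub_const t) measurable_snd).inter
      ((measurableSet_le measurable_snd measurable_fst).inter (measurable_fst hS.measurableSet))
  have hfun : Measurable (T.indicator fun p : ℝ × ℝ => ‖deriv f p.1‖ₑ * relChange f t p.2) :=
    ((hd.comp measurable_fst).mul (hr.comp measurable_snd)).indicator hTm
  calc meanGap f S t
      ≤ ∫⁻ y in overlap S t, ∫⁻ x,
          T.indicator (fun p : ℝ × ℝ => ‖deriv f p.1‖ₑ * relChange f t p.2) (x, y) := by
        refine setLIntegral_mono' (measurableSet_overlap hS t) fun y hy => ?_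
        have hIcc : Icc y (y + t) ⊆ S := hS'.out hy.1 hy.2
        have h1 := enorm_sub_le_lintegral_deriv_of_contDiffOn_Icc (hf.contDiffOn.mono hIcc)
          (le_add_of_nonneg_right ht.le)
        have h2 : ENNReal.ofReal ((f (y + t) - f y) ^ 2 / max (f (y + t)) (f y))
            = ‖f (y + t) - f y‖ₑ * relChange f t y := by
          rw [relChange, Real.enorm_eq_ofReal_abs, ← ENNReal.ofReal_mul (abs_nonneg _),
            ← mul_div_assoc, ← pow_two, sq_abs]
        rw [h2]
        refine (mul_le_mul_left h1 _).trans ?_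
        rw [← lintegral_mul_const _ hd, ← lintegral_indicator measurableSet_Icc]
        refine lintegral_mono fun x => ?_
        by_cases hx : x ∈ Icc y (y + t)
        · rw [indicator_of_mem hx, indicator_of_mem]
          exact ⟨sub_le_iff_le_add.mpr hx.2, hx.1, hIcc hx⟩
        · rw [indicator_of_notMem hx]
          exact zero_le
    _ ≤ ∫⁻ y, ∫⁻ x,
          T.indicator (fun p : ℝ × ℝ => ‖deriv f p.1‖ₑ * relChange f t p.2) (x, y) :=
        setLIntegral_le_lintegral _ _
    _ = ∫⁻ x, ∫⁻ y,
          T.indicator (fun p : ℝ × ℝ => ‖deriv f p.1‖ₑ * relChange f t p.2) (x, y) :=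
        lintegral_lintegral_swap (hfun.comp measurable_swap).aemeasurable
    _ = ∫⁻ x in S, ‖deriv f x‖ₑ * ∫⁻ y in Icc (x - t) x, relChange f t y := by
        rw [← lintegral_indicator hS.measurableSet]
        refine lintegral_congr fun x => ?_
        by_cases hx : x ∈ S
        · rw [indicator_of_mem hx, ← lintegral_const_mul _ hr,
            ← lintegral_indicator measurableSet_Icc]
          refine lintegral_congr fun y => ?_
          by_cases hy : y ∈ Icc (x - t) x
          · rw [indicator_of_mem hy, indicator_of_mem]
            exact ⟨hy.1, hy.2, hx⟩
          · rw [indicator_of_notMem hy, indicator_of_notMem]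
            exact fun h => hy ⟨h.1, h.2.1⟩
        · rw [indicator_of_notMem hx]
          refine lintegral_eq_zero_of_ae_eq_zero (.of_forall fun y => ?_)
          exact indicator_of_notMem (fun h => hx h.2.2) _

/-- The means of the relative change over short intervals are small at every point of `S`. -/
theorem tendsto_mean_relChange (hf : IsSmoothPdfOn f S) (hS : IsOpen S) {x : ℝ} (hx : x ∈ S) :
    Tendsto (fun t : ℝ => (∫⁻ y in Icc (x - t) x, relChange f t y) / ENNReal.ofReal t)
      (𝓝[>] 0) (𝓝 0) := by
  rw [ENNReal.tendsto_nhds_zero]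
  intro η hη
  obtain ⟨e, he0, heη⟩ : ∃ e : ℝ, 0 < e ∧ ENNReal.ofReal e ≤ η := by
    by_cases h : η = ⊤
    · exact ⟨1, one_pos, h ▸ le_top⟩
    · exact ⟨η.toReal, ENNReal.toReal_pos hη.ne' h, ENNReal.ofReal_toReal_le⟩
  have hfx := hf.pos x hx
  have hc : ContinuousAt f x := hf.contDiffOn.continuousOn.continuousAt (hS.mem_nhds hx)
  -- The bound f x / 2 keeps the maximum in the denominator above f x / 2; the bound e * f x / 4,
  -- used at both points, keeps the increment below e * f x / 2.
  have hρ : 0 < min (f x / 2) (e * f x / 4) := by positivity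
  obtain ⟨r, hr0, hr⟩ := Metric.continuousAt_iff.mp hc _ hρ
  filter_upwards [Ioo_mem_nhdsGT hr0] with t ht
  have hle : ∀ y ∈ Icc (x - t) x, relChange f t y ≤ ENNReal.ofReal e := by
    intro y hy
    have h1 := hr (x := y) (by
      rw [Real.dist_eq, abs_lt]
      constructor <;> linarith [hy.1, hy.2, ht.1, ht.2])
    have h2 := hr (x := y + t) (by
      rw [Real.dist_eq, abs_lt]
      constructor <;> linarith [hy.1, hy.2, ht.1, ht.2])
    rw [Real.dist_eq] at h1 h2
    have h1a := abs_lt.mp (h1.trans_le (min_le_left _ _))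
    have h1b := abs_lt.mp (h1.trans_le (min_le_right _ _))
    have h2b := abs_lt.mp (h2.trans_le (min_le_right _ _))
    refine ENNReal.ofReal_le_ofReal ?_
    have hm : f x / 2 ≤ max (f (y + t)) (f y) := le_max_of_le_right (by linarith)
    rw [div_le_iff₀ (by linarith)]
    calc |f (y + t) - f y| ≤ e * (f x / 2) := by rw [abs_le]; constructor <;> linarith
      _ ≤ _ := by gcongr
  refine ENNReal.div_le_of_le_mul ?_
  calc ∫⁻ y in Icc (x - t) x, relChange f t y ≤ ∫⁻ _ in Icc (x - t) x, ENNReal.ofReal e :=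
        setLIntegral_mono' measurableSet_Icc hle
    _ = ENNReal.ofReal e * ENNReal.ofReal t := by
        rw [setLIntegral_const, Real.volume_Icc, sub_sub_cancel]
    _ ≤ η * ENNReal.ofReal t := by gcongr

/-- After division by t the inner integral is a mean of relative changes, at most 1 and tending to 0
on `S`, so dominated convergence applies with majorant |f'|. -/
theorem tendsto_meanGap_div (hf : IsSmoothPdfOn f S) (hS : IsOpen S) (hS' : S.OrdConnected) :
    Tendsto (fun t : ℝ => meanGap f S t / ENNReal.ofReal t) (𝓝[>] 0) (𝓝 0) := by
  have hfm := hf.measurable hS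
  have hd : Measurable fun x => ‖deriv f x‖ₑ := (measurable_deriv f).enorm
  set H : ℝ → ℝ → ℝ≥0∞ := fun t x =>
    (∫⁻ y in Icc (x - t) x, relChange f t y) / ENNReal.ofReal t with hH
  have hHm : ∀ t, Measurable (H t) := fun t => by
    refine Measurable.div_const ?_ _
    have h1 : ∀ x, ∫⁻ y in Icc (x - t) x, relChange f t y
        = ∫⁻ y, ({p : ℝ × ℝ | p.1 - t ≤ p.2} ∩ {p | p.2 ≤ p.1}).indicator
            (fun p => relChange f t p.2) (x, y) := fun x => by
      rw [← lintegral_indicator measurableSet_Icc]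
      rfl
    simp_rw [h1]
    refine Measurable.lintegral_prod_right ?_
    exact ((measurable_relChange hfm t).comp measurable_snd).indicator
      ((measurableSet_le (measurable_fst.sub_const t) measurable_snd).inter
        (measurableSet_le measurable_snd measurable_fst))
  have hH1 : ∀ t > 0, ∀ x, H t x ≤ 1 := fun t ht x => by
    refine ENNReal.div_le_of_le_mul ?_
    calc ∫⁻ y in Icc (x - t) x, relChange f t y ≤ ∫⁻ _ in Icc (x - t) x, 1 :=
          lintegral_mono fun y => relChange_le_one hf t y
      _ = 1 * ENNReal.ofReal t := by
          rw [setLIntegral_const, Real.volume_Icc, sub_sub_cancel]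
  have hlim : Tendsto (fun t => ∫⁻ x in S, ‖deriv f x‖ₑ * H t x) (𝓝[>] 0)
      (𝓝 (∫⁻ _ in S, 0)) := by
    refine tendsto_lintegral_filter_of_dominated_convergence (fun x => ‖deriv f x‖ₑ)
      (.of_forall fun t => hd.mul (hHm t)) ?_ hf.integrableOn_deriv.hasFiniteIntegral.ne ?_
    · filter_upwards [self_mem_nhdsWithin] with t ht
      exact .of_forall fun x => mul_le_of_le_one_right zero_le (hH1 t ht x)
    · filter_upwards [self_mem_ae_restrict hS.measurableSet] with x hx
      have := ENNReal.Tendsto.const_mul (tendsto_mean_relChange hf hS hx)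
        (a := ‖deriv f x‖ₑ) (Or.inr enorm_ne_top)
      rwa [mul_zero] at this
  rw [lintegral_zero] at hlim
  refine tendsto_of_tendsto_of_tendsto_of_le_of_le' tendsto_const_nhds hlim
    (.of_forall fun _ => zero_le) ?_
  filter_upwards [self_mem_nhdsWithin] with t ht
  refine (ENNReal.div_le_div_right (meanGap_le hf hS hS' ht) _).trans_eq ?_
  have ht' : (ENNReal.ofReal t)⁻¹ ≠ ⊤ := by simpa using ht
  rw [div_eq_mul_inv, ← lintegral_mul_const' _ _ ht']
  simp only [hH, div_eq_mul_inv, mul_assoc]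

theorem eventually_meanGap_le (hf : IsSmoothPdfOn f S) (hS : IsOpen S) (hS' : S.OrdConnected)
    {δ : ℝ} (hδ : 0 < δ) : ∀ᶠ t in 𝓝[>] (0 : ℝ), meanGap f S t ≤ ENNReal.ofReal (δ * t) := by
  have h := (tendsto_meanGap_div hf hS hS').eventually_le_const (ENNReal.ofReal_pos.mpr hδ)
  filter_upwards [h, self_mem_nhdsWithin] with t h1 ht
  rw [ENNReal.div_le_iff (ENNReal.ofReal_pos.mpr ht).ne' ENNReal.ofReal_ne_top,
    ← ENNReal.ofReal_mul hδ.le] at h1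
  exact h1

/-! ### Affinity expansion and Rényi limit -/

/-- The integral `∫ f(y + t)^s f(y)^(1-s) dy`. -/
noncomputable def shiftAffinity (f : ℝ → ℝ) (s t : ℝ) : ℝ≥0∞ :=
  ∫⁻ y, ENNReal.ofReal (f (y + t) ^ s * f y ^ (1 - s))

theorem lintegral_locationFamily_eq (f : ℝ → ℝ) (s θ₁ θ₂ : ℝ) :
    ∫⁻ x, ENNReal.ofReal (locationFamily f θ₁ x ^ s * locationFamily f θ₂ x ^ (1 - s))
      = shiftAffinity f s (θ₂ - θ₁) := by
  rw [shiftAffinity, ← lintegral_sub_right_eq_self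
    (fun y => ENNReal.ofReal (f (y + (θ₂ - θ₁)) ^ s * f y ^ (1 - s))) θ₂]
  refine lintegral_congr fun x => ?_
  rw [locationFamily, locationFamily, show x - θ₂ + (θ₂ - θ₁) = x - θ₁ by ring]

theorem renyi_locationFamily (f : ℝ → ℝ) (s θ ε : ℝ) :
    renyi s (locationFamily f (θ - ε / 2)) (locationFamily f (θ + ε / 2))
      = -ENNReal.log (shiftAffinity f s ε) := by
  rw [renyi, lintegral_locationFamily_eq, show θ + ε / 2 - (θ - ε / 2) = ε by ring]

/-- Both exponents must be positive here: since 0 ^ 0 = 1, the end values s = 0 and s = 1 would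
count mass outside the overlap. -/
theorem shiftAffinity_eq_overlap (hf : IsSmoothPdfOn f S) (hS : IsOpen S) {s : ℝ}
    (hs : s ∈ Ioo (0 : ℝ) 1) (t : ℝ) :
    shiftAffinity f s t
      = ∫⁻ y in overlap S t, ENNReal.ofReal (f (y + t) ^ s * f y ^ (1 - s)) := by
  rw [shiftAffinity, ← lintegral_indicator (measurableSet_overlap hS t)]
  refine lintegral_congr fun y => ?_
  by_cases hy : y ∈ overlap S t
  · rw [indicator_of_mem hy]
  · rw [indicator_of_notMem hy]
    by_cases h : y ∈ S
    · rw [hf.zero (y + t) fun h' => hy ⟨h, h'⟩, Real.zero_rpow hs.1.ne', zero_mul,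
        ENNReal.ofReal_zero]
    · rw [hf.zero y h, Real.zero_rpow (sub_pos.mpr hs.2).ne', mul_zero, ENNReal.ofReal_zero]

theorem setLIntegral_overlap_shift (hf : IsSmoothPdfOn f S) (hS : IsOpen S) (t : ℝ) :
    ∫⁻ y in overlap S t, ENNReal.ofReal (f (y + t)) = densityMeasure f {z | z - t ∈ S} := by
  have hm : MeasurableSet {z | z - t ∈ S} := (measurable_id.sub_const t) hS.measurableSet
  rw [densityMeasure, withDensity_apply _ hm, ← lintegral_indicator hm,
    ← lintegral_indicator (measurableSet_overlap hS t),
    ← lintegral_add_right_eq_self ({z | z - t ∈ S}.indicator fun z => ENNReal.ofReal (f z)) t]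
  refine lintegral_congr fun y => ?_
  have h : y + t ∈ {z | z - t ∈ S} ↔ y ∈ S := by
    rw [← add_sub_cancel_right y t]
    simp only [sub_add_cancel]
    exact Iff.rfl
  classical
  simp only [indicator_apply, h, show y ∈ overlap S t ↔ y ∈ S ∧ y + t ∈ S from Iff.rfl]
  by_cases hy : y + t ∈ S
  · simp [hy]
  · simp [hf.zero _ hy]

theorem setLIntegral_overlap (hf : IsSmoothPdfOn f S) (hS : IsOpen S) (t : ℝ) :
    ∫⁻ y in overlap S t, ENNReal.ofReal (f y) = densityMeasure f {z | z + t ∈ S} := by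
  have hm : MeasurableSet {z | z + t ∈ S} := (measurable_id.add_const t) hS.measurableSet
  rw [densityMeasure, withDensity_apply _ hm, ← lintegral_indicator hm,
    ← lintegral_indicator (measurableSet_overlap hS t)]
  refine lintegral_congr fun y => ?_
  classical
  simp only [indicator_apply, show y ∈ overlap S t ↔ y ∈ S ∧ y + t ∈ S from Iff.rfl,
    show y ∈ {z | z + t ∈ S} ↔ y + t ∈ S from Iff.rfl]
  by_cases hy : y ∈ S
  · simp [hy]
  · simp [hf.zero _ hy]

theorem lintegral_overlap_mean (hf : IsSmoothPdfOn f S) (hS : IsOpen S) {s : ℝ}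
    (hs : s ∈ Ioo (0 : ℝ) 1) (t : ℝ) :
    ∫⁻ y in overlap S t, ENNReal.ofReal (s * f (y + t) + (1 - s) * f y)
      = ENNReal.ofReal s * densityMeasure f {z | z - t ∈ S}
        + ENNReal.ofReal (1 - s) * densityMeasure f {z | z + t ∈ S} := by
  have hfm := hf.measurable hS
  have hs1 := (sub_pos.mpr hs.2).le
  have h : ∀ y, ENNReal.ofReal (s * f (y + t) + (1 - s) * f y)
      = ENNReal.ofReal s * ENNReal.ofReal (f (y + t))
        + ENNReal.ofReal (1 - s) * ENNReal.ofReal (f y) := fun y => by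
    rw [ENNReal.ofReal_add (mul_nonneg hs.1.le (hf.nonneg _)) (mul_nonneg hs1 (hf.nonneg _)),
      ENNReal.ofReal_mul hs.1.le, ENNReal.ofReal_mul hs1]
  simp_rw [h]
  rw [lintegral_add_left (by fun_prop), lintegral_const_mul _ (by fun_prop),
    lintegral_const_mul _ (by fun_prop), setLIntegral_overlap_shift hf hS,
    setLIntegral_overlap hf hS]

theorem shiftAffinity_le (hf : IsSmoothPdfOn f S) (hS : IsOpen S) {s : ℝ}
    (hs : s ∈ Ioo (0 : ℝ) 1) (t : ℝ) :
    shiftAffinity f s t ≤ ENNReal.ofReal s * densityMeasure f {z | z - t ∈ S}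
        + ENNReal.ofReal (1 - s) * densityMeasure f {z | z + t ∈ S} := by
  rw [shiftAffinity_eq_overlap hf hS hs, ← lintegral_overlap_mean hf hS hs]
  exact lintegral_mono fun y => ENNReal.ofReal_le_ofReal
    (Real.geom_mean_le_arith_mean2_weighted hs.1.le (sub_pos.mpr hs.2).le (hf.nonneg _)
      (hf.nonneg _) (by ring))

/-- Both values are positive on the overlap, so the quadratic bound on the gap between the means can
be integrated. The additive form avoids truncated subtraction. -/
theorem le_shiftAffinity_add_meanGap (hf : IsSmoothPdfOn f S) (hS : IsOpen S) {s : ℝ}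
    (hs : s ∈ Ioo (0 : ℝ) 1) (t : ℝ) :
    ENNReal.ofReal s * densityMeasure f {z | z - t ∈ S}
        + ENNReal.ofReal (1 - s) * densityMeasure f {z | z + t ∈ S}
      ≤ shiftAffinity f s t + meanGap f S t := by
  have hfm := hf.measurable hS
  rw [shiftAffinity_eq_overlap hf hS hs, ← lintegral_overlap_mean hf hS hs, meanGap,
    ← lintegral_add_left (by fun_prop)]
  refine setLIntegral_mono' (measurableSet_overlap hS t) fun y hy => ?_
  refine (ENNReal.ofReal_le_ofReal
    (weighted_arith_mean_le (hf.pos _ hy.2) (hf.pos _ hy.1) hs)).trans ENNReal.ofReal_add_le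

/-- First order expansion of the affinity of the density and its shift, uniform in `s`. -/
theorem eventually_shiftAffinity_linear (hf : IsSmoothPdfOn f S) (hS : IsOpen S)
    (hS' : S.OrdConnected) (hA : HasEdgeSlopes f S A₁ A₂) {δ : ℝ} (hδ : 0 < δ) :
    ∀ᶠ t in 𝓝[>] (0 : ℝ), ∀ s ∈ Ioo (0 : ℝ) 1,
      ENNReal.ofReal (1 - (A₁ * s + A₂ * (1 - s) + δ) * t) ≤ shiftAffinity f s t ∧
      shiftAffinity f s t ≤ ENNReal.ofReal (1 - (A₁ * s + A₂ * (1 - s) - δ) * t) := by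
  have hδ2 : 0 < δ / 2 := half_pos hδ
  -- `ENNReal.ofReal` truncates at 0, so the convex combination of the two edge masses can be merged
  -- into one `ENNReal.ofReal` only while both arguments are nonnegative.
  have h0 : ∀ A : ℝ, ∀ᶠ t in 𝓝[>] (0 : ℝ), 0 ≤ 1 - A * t := fun A => by
    have : Tendsto (fun t : ℝ => 1 - A * t) (𝓝[>] 0) (𝓝 (1 - A * 0)) :=
      ((continuous_const.sub (continuous_const.mul continuous_id)).tendsto 0).mono_left
        nhdsWithin_le_nhds
    rw [mul_zero, sub_zero] at this
    exact (this.eventually (lt_mem_nhds one_pos)).mono fun t ht => ht.le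
  filter_upwards [hA.left _ hδ2, hA.right _ hδ2, eventually_meanGap_le hf hS hS' hδ2,
    h0 (A₁ + δ / 2), h0 (A₂ + δ / 2), h0 (A₁ - δ / 2), h0 (A₂ - δ / 2), self_mem_nhdsWithin]
    with t hl hr hK p1 p2 p3 p4 ht s hs
  have ht : 0 < t := ht
  have hs0 := hs.1
  have hs1 : 0 < 1 - s := sub_pos.mpr hs.2
  have hcomb : ∀ {x y : ℝ}, 0 ≤ x → 0 ≤ y →
      ENNReal.ofReal s * ENNReal.ofReal x + ENNReal.ofReal (1 - s) * ENNReal.ofReal y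
        = ENNReal.ofReal (s * x + (1 - s) * y) := fun hx hy => by
    rw [ENNReal.ofReal_add (by positivity) (by positivity), ENNReal.ofReal_mul hs0.le,
      ENNReal.ofReal_mul hs1.le]
  constructor
  · have h1 := (add_le_add (mul_le_mul_right hl.1 (ENNReal.ofReal s))
      (mul_le_mul_right hr.1 (ENNReal.ofReal (1 - s)))).trans
      ((le_shiftAffinity_add_meanGap hf hS hs t).trans (add_le_add_right hK _))
    rw [hcomb p1 p2] at h1
    calc _ = ENNReal.ofReal (s * (1 - (A₁ + δ / 2) * t) + (1 - s) * (1 - (A₂ + δ / 2) * t)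
              - δ / 2 * t) := by congr 1; ring
      _ = _ - ENNReal.ofReal (δ / 2 * t) := ENNReal.ofReal_sub _ (by positivity)
      _ ≤ _ := tsub_le_iff_right.mpr h1
  · have h1 := (shiftAffinity_le hf hS hs t).trans
      (add_le_add (mul_le_mul_right hl.2 (ENNReal.ofReal s))
        (mul_le_mul_right hr.2 (ENNReal.ofReal (1 - s))))
    rw [hcomb p3 p4] at h1
    refine h1.trans (ENNReal.ofReal_le_ofReal ?_)
    nlinarith [mul_pos hδ ht]

/-- Near zero, `1 - c t` exceeds a slightly steeper exponential, uniformly for bounded `c`. -/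
theorem eventually_exp_le_linear {C δ : ℝ} (hδ : 0 < δ) :
    ∀ᶠ t in 𝓝[>] (0 : ℝ), ∀ c ∈ Icc (0 : ℝ) C, Real.exp (-(c + δ) * t) ≤ 1 - (c + δ / 2) * t := by
  by_cases hC : 0 ≤ C
  -- With x = (c + δ)t, the first bound gives x ≤ 1, hence exp(-x) ≤ 1 - x + x²; the second gives x²
  -- ≤ δt/2.
  · have h1 : 0 < min (1 / (C + δ)) (δ / 2 / (C + δ) ^ 2) := by positivity
    filter_upwards [Ioo_mem_nhdsGT h1] with t ht c hc
    have ht0 := ht.1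
    have h2 : t * (C + δ) < 1 := (lt_div_iff₀ (by positivity)).mp (ht.2.trans_le (min_le_left _ _))
    have h3 : t * (C + δ) ^ 2 < δ / 2 :=
      (lt_div_iff₀ (by positivity)).mp (ht.2.trans_le (min_le_right _ _))
    have hcC : (c + δ) * t ≤ (C + δ) * t := by gcongr; exact hc.2
    have hc0 : 0 ≤ (c + δ) * t := mul_nonneg (add_nonneg hc.1 hδ.le) ht0.le
    have h4 := Real.abs_exp_sub_one_sub_id_le (x := -(c + δ) * t) (by
      rw [abs_le]; constructor <;> nlinarith)
    have h5 : ((c + δ) * t) ^ 2 ≤ ((C + δ) * t) ^ 2 := pow_le_pow_left₀ hc0 hcC 2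
    have h6 := (abs_le.mp h4).2
    nlinarith
  · exact .of_forall fun t c hc => absurd (hc.1.trans hc.2) hC

theorem one_sub_mul_le_exp (c t : ℝ) : 1 - c * t ≤ Real.exp (-c * t) := by
  have := Real.add_one_le_exp (-c * t)
  linarith

theorem eventually_shiftAffinity_exp (hf : IsSmoothPdfOn f S) (hS : IsOpen S)
    (hS' : S.OrdConnected) (hA : HasEdgeSlopes f S A₁ A₂) {δ : ℝ} (hδ : 0 < δ) :
    ∀ᶠ t in 𝓝[>] (0 : ℝ), ∀ s ∈ Ioo (0 : ℝ) 1,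
      ENNReal.ofReal (Real.exp (-(A₁ * s + A₂ * (1 - s) + δ) * t)) ≤ shiftAffinity f s t ∧
      shiftAffinity f s t ≤ ENNReal.ofReal (Real.exp (-(A₁ * s + A₂ * (1 - s) - δ) * t)) := by
  filter_upwards [eventually_shiftAffinity_linear hf hS hS' hA (half_pos hδ),
    eventually_exp_le_linear (C := A₁ + A₂) hδ, self_mem_nhdsWithin] with t h1 h2 ht s hs
  have ht : 0 < t := ht
  have ha := hA.left_nonneg
  have hb := hA.right_nonneg
  have hs1 : 0 < 1 - s := sub_pos.mpr hs.2
  have hc : A₁ * s + A₂ * (1 - s) ∈ Icc 0 (A₁ + A₂) :=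
    ⟨add_nonneg (mul_nonneg ha hs.1.le) (mul_nonneg hb hs1.le), by nlinarith [hs.1]⟩
  refine ⟨(ENNReal.ofReal_le_ofReal (h2 _ hc)).trans (h1 s hs).1,
    (h1 s hs).2.trans (ENNReal.ofReal_le_ofReal ((one_sub_mul_le_exp _ _).trans ?_))⟩
  rw [Real.exp_le_exp]
  nlinarith

theorem eventually_renyiQuotient (hf : IsSmoothPdfOn f S) (hS : IsOpen S)
    (hS' : S.OrdConnected) (hA : HasEdgeSlopes f S A₁ A₂) (θ : ℝ) {δ : ℝ} (hδ : 0 < δ) :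
    ∀ᶠ ε in 𝓝[>] (0 : ℝ), ∀ s ∈ Ioo (0 : ℝ) 1,
      ((A₁ * s + A₂ * (1 - s) - δ : ℝ) : EReal)
        ≤ renyiQuotient (fun x => |x|) (locationFamily f) θ s ε ∧
      renyiQuotient (fun x => |x|) (locationFamily f) θ s ε
        ≤ ((A₁ * s + A₂ * (1 - s) + δ : ℝ) : EReal) := by
  filter_upwards [eventually_shiftAffinity_exp hf hS hS' hA hδ, self_mem_nhdsWithin]
    with ε h ht s hs
  have ht : 0 < ε := ht
  have ht' : (0 : EReal) < ((|ε| : ℝ) : EReal) := by exact_mod_cast abs_pos.mpr ht.ne'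
  obtain ⟨h1, h2⟩ := h s hs
  have h1 := EReal.neg_le_neg_iff.mpr (ENNReal.log_le_log h1)
  have h2 := EReal.neg_le_neg_iff.mpr (ENNReal.log_le_log h2)
  rw [ENNReal.log_ofReal_of_pos (Real.exp_pos _), Real.log_exp, ← EReal.coe_neg] at h1 h2
  rw [renyiQuotient, renyi_locationFamily]
  refine ⟨(EReal.le_div_iff_mul_le ht' (EReal.coe_ne_top _)).mpr (le_trans (le_of_eq ?_) h2),
    (EReal.div_le_iff_le_mul ht' (EReal.coe_ne_top _)).mpr (h1.trans (le_of_eq ?_))⟩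
  · rw [← EReal.coe_mul, abs_of_pos ht]; congr 1; ring
  · rw [← EReal.coe_mul, abs_of_pos ht]; congr 1; ring

theorem tendsto_coe_of_eventually_mem {l : Filter ℝ} {F : ℝ → EReal} {c : ℝ}
    (h : ∀ δ : ℝ, 0 < δ → ∀ᶠ ε in l, ((c - δ : ℝ) : EReal) ≤ F ε ∧ F ε ≤ ((c + δ : ℝ) : EReal)) :
    Tendsto F l (𝓝 (c : EReal)) := by
  refine tendsto_order.mpr ⟨fun x hx => ?_, fun x hx => ?_⟩
  · obtain ⟨y, hxy, hy⟩ := EReal.lt_iff_exists_real_btwn.mp hx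
    have hy : y < c := by exact_mod_cast hy
    filter_upwards [h (c - y) (sub_pos.mpr hy)] with ε hε
    rw [sub_sub_cancel] at hε
    exact hxy.trans_le hε.1
  · obtain ⟨y, hy, hxy⟩ := EReal.lt_iff_exists_real_btwn.mp hx
    have hy : c < y := by exact_mod_cast hy
    filter_upwards [h (y - c) (sub_pos.mpr hy)] with ε hε
    rw [add_sub_cancel] at hε
    exact hε.2.trans_lt hxy

theorem renyiLimit_eq (hf : IsSmoothPdfOn f S) (hS : IsOpen S)
    (hS' : S.OrdConnected) (hA : HasEdgeSlopes f S A₁ A₂) (θ : ℝ) {s : ℝ}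
    (hs : s ∈ Ioo (0 : ℝ) 1) :
    renyiLimit (fun x => |x|) (locationFamily f) θ s = ((A₁ * s + A₂ * (1 - s) : ℝ) : EReal) :=
  (tendsto_coe_of_eventually_mem fun _ hδ =>
    (eventually_renyiQuotient hf hS hS' hA θ hδ).mono fun _ h => h s hs).limsup_eq

/-! ### Upper bounds for all estimators -/

/-- The geometric mean of two shifts of the density. -/
noncomputable def sqrtDensity (f : ℝ → ℝ) (θ₁ θ₂ x : ℝ) : ℝ≥0∞ :=
  ENNReal.ofReal (f (x - θ₁)) ^ (1 / 2 : ℝ) * ENNReal.ofReal (f (x - θ₂)) ^ (1 / 2 : ℝ)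

theorem sqrtDensity_comm (f : ℝ → ℝ) (θ₁ θ₂ : ℝ) : sqrtDensity f θ₁ θ₂ = sqrtDensity f θ₂ θ₁ :=
  funext fun _ => mul_comm _ _

theorem lintegral_sqrtDensity (hf : IsSmoothPdfOn f S) (θ₁ θ₂ : ℝ) :
    ∫⁻ x, sqrtDensity f θ₁ θ₂ x = shiftAffinity f (1 / 2) (θ₂ - θ₁) := by
  rw [← lintegral_locationFamily_eq]
  refine lintegral_congr fun x => ?_
  rw [sqrtDensity, locationFamily, locationFamily, show (1 - 1 / 2 : ℝ) = 1 / 2 by norm_num,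
    ENNReal.ofReal_mul (Real.rpow_nonneg (hf.nonneg _) _),
    ENNReal.ofReal_rpow_of_nonneg (hf.nonneg _) (by norm_num),
    ENNReal.ofReal_rpow_of_nonneg (hf.nonneg _) (by norm_num)]

theorem isFiniteMeasure_sqrtDensity (hf : IsSmoothPdfOn f S) (hS : IsOpen S) (θ₁ θ₂ : ℝ) :
    IsFiniteMeasure (volume.withDensity (sqrtDensity f θ₁ θ₂)) := by
  have := hf.isProbabilityMeasure_densityMeasure
  refine isFiniteMeasure_withDensity ?_
  rw [lintegral_sqrtDensity hf]
  refine ne_top_of_le_ne_top ?_ (shiftAffinity_le hf hS (by norm_num) _)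
  exact ENNReal.add_ne_top.mpr ⟨ENNReal.mul_ne_top ENNReal.ofReal_ne_top (measure_ne_top _ _),
    ENNReal.mul_ne_top ENNReal.ofReal_ne_top (measure_ne_top _ _)⟩

/-- The Cauchy-Schwarz bound for two members of the location family. Only the part of the second
member that lies in the support of the first one counts. -/
theorem pi_sqrtDensity_sq_le (hf : IsSmoothPdfOn f S) (hS : IsOpen S) (θ₁ θ₂ : ℝ) {n : ℕ}
    {E : Set (Fin n → ℝ)} (hE : MeasurableSet E) :
    Measure.pi (fun _ : Fin n => volume.withDensity (sqrtDensity f θ₁ θ₂)) E ^ 2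
      ≤ Measure.pi (fun _ : Fin n => densityMeasure (locationFamily f θ₁)) E
        * densityMeasure f {z | z + (θ₂ - θ₁) ∈ S} ^ n := by
  have hfm := hf.measurable hS
  have hm : MeasurableSet ((fun x => x - θ₁) ⁻¹' S) :=
    (measurable_id.sub_const θ₁) hS.measurableSet
  set u : ℝ → ℝ≥0∞ := fun x => ENNReal.ofReal (f (x - θ₁)) with hu
  -- Cutting the second density down to the support of the first leaves the geometric mean
  -- unchanged, but lowers the Cauchy-Schwarz factor below 1 by the edge loss.
  set v : ℝ → ℝ≥0∞ :=
    ((fun x => x - θ₁) ⁻¹' S).indicator fun x => ENNReal.ofReal (f (x - θ₂)) with hv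
  have hum : Measurable u := by fun_prop
  have hvm : Measurable v := Measurable.indicator (by fun_prop) hm
  have huv : sqrtDensity f θ₁ θ₂ = fun x => u x ^ (1 / 2 : ℝ) * v x ^ (1 / 2 : ℝ) := by
    funext x
    by_cases hx : x - θ₁ ∈ S
    · rw [sqrtDensity, hv, indicator_of_mem (show x ∈ (fun x => x - θ₁) ⁻¹' S from hx)]
    · simp only [sqrtDensity, hu, hf.zero _ hx, ENNReal.ofReal_zero]
      rw [ENNReal.zero_rpow_of_pos (by norm_num), zero_mul, zero_mul]
  have hO : MeasurableSet {z | z + (θ₂ - θ₁) ∈ S} :=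
    (measurable_id.add_const (θ₂ - θ₁)) hS.measurableSet
  have hpre : (fun x => x - θ₁) ⁻¹' S = (fun x => x - θ₂) ⁻¹' {z | z + (θ₂ - θ₁) ∈ S} := by
    ext x
    change x - θ₁ ∈ S ↔ x - θ₂ + (θ₂ - θ₁) ∈ S
    rw [show x - θ₂ + (θ₂ - θ₁) = x - θ₁ by ring]
  have hvi : ∫⁻ x, v x = densityMeasure f {z | z + (θ₂ - θ₁) ∈ S} := by
    rw [← IsSmoothPdfOn.densityMeasure_locationFamily_apply θ₂ hO, ← hpre, densityMeasure, hv,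
      lintegral_indicator hm, withDensity_apply _ hm]
    rfl
  have := hf.isProbabilityMeasure_locationFamily θ₁
  have i1 : IsFiniteMeasure (volume.withDensity u) :=
    inferInstanceAs (IsFiniteMeasure (densityMeasure (locationFamily f θ₁)))
  have := hf.isProbabilityMeasure_densityMeasure
  have i2 : IsFiniteMeasure (volume.withDensity v) :=
    isFiniteMeasure_withDensity (hvi ▸ measure_ne_top _ _)
  have i3 := isFiniteMeasure_sqrtDensity hf hS θ₁ θ₂
  rw [huv] at i3 ⊢
  rw [← hvi]
  exact pi_withDensity_sqrt_sq_le hum hvm hE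

/-- If N is at least half of J^n, then P ≥ N²/Q^n ≥ J^(2n)/(4Q^n), which has exponent 2j - q. The
factor 4 is the square of the 2 from the halving. -/
theorem exp_pow_le_of_affinity {J N P Q : ℝ≥0∞} {n : ℕ} {j q r : ℝ} (hr : r = 2 * j - q)
    (hJ : ENNReal.ofReal (Real.exp (-j)) ≤ J) (hQ : Q ≤ ENNReal.ofReal (Real.exp (-q)))
    (hN : J ^ n ≤ 2 * N) (hNP : N ^ 2 ≤ P * Q ^ n) :
    ENNReal.ofReal (Real.exp (-r)) ^ n ≤ 4 * P := by
  have hq0 : ENNReal.ofReal (Real.exp (-q)) ≠ 0 := (ENNReal.ofReal_pos.mpr (Real.exp_pos _)).ne'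
  have h1 : ENNReal.ofReal (Real.exp (-r)) * ENNReal.ofReal (Real.exp (-q))
      = ENNReal.ofReal (Real.exp (-j)) ^ 2 := by
    rw [← ENNReal.ofReal_mul (Real.exp_pos _).le, ← Real.exp_add,
      ← ENNReal.ofReal_pow (Real.exp_pos _).le, ← Real.exp_nat_mul, hr]
    congr 2
    push_cast
    ring
  refine (ENNReal.mul_le_mul_iff_left (pow_ne_zero n hq0)
    (ENNReal.pow_ne_top ENNReal.ofReal_ne_top)).mp ?_
  calc _ = (ENNReal.ofReal (Real.exp (-j)) ^ n) ^ 2 := by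
        rw [← mul_pow, h1, ← pow_mul, ← pow_mul, mul_comm]
    _ ≤ (J ^ n) ^ 2 := by gcongr
    _ ≤ (2 * N) ^ 2 := by gcongr
    _ = 4 * N ^ 2 := by rw [mul_pow]; norm_num
    _ ≤ 4 * (P * Q ^ n) := by gcongr
    _ ≤ 4 * P * ENNReal.ofReal (Real.exp (-q)) ^ n := by rw [mul_assoc]; gcongr

/-- No estimator has large error rates at two parameters whose distance is the sum of the radii. -/
theorem eventually_errorRate_le_or (hf : IsSmoothPdfOn f S) (hS : IsOpen S)
    (hS' : S.OrdConnected) (hA : HasEdgeSlopes f S A₁ A₂) {δ : ℝ} (hδ : 0 < δ) :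
    ∀ᶠ d in 𝓝[>] (0 : ℝ), ∀ (T : Estimator) (θ₁ θ₂ ε₁ ε₂ : ℝ), θ₂ - θ₁ = d → ε₁ + ε₂ = d →
      errorRate (locationFamily f) T θ₁ ε₁ ≤ (((A₁ + δ) * d : ℝ) : EReal) ∨
      errorRate (locationFamily f) T θ₂ ε₂ ≤ (((A₂ + δ) * d : ℝ) : EReal) := by
  -- The exponent is 2j - q: the affinity enters twice and the edge mass once, three errors of δ/3.
  have hη : 0 < δ / 3 := by positivity
  filter_upwards [hA.left _ hη, hA.right _ hη, eventually_shiftAffinity_exp hf hS hS' hA hη]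
    with d hl hr hJ T θ₁ θ₂ ε₁ ε₂ hθ hε
  have hJ := (hJ (1 / 2) (by norm_num)).1
  rw [neg_mul] at hJ
  have hl := hl.2.trans (ENNReal.ofReal_le_ofReal (one_sub_mul_le_exp _ _))
  have hr := hr.2.trans (ENNReal.ofReal_le_ofReal (one_sub_mul_le_exp _ _))
  rw [neg_mul] at hl hr
  have i3 := isFiniteMeasure_sqrtDensity hf hS θ₁ θ₂
  set E₁ : ∀ n : ℕ, Set (Fin n → ℝ) := fun n => {x | ε₁ ≤ |T.toFun n x - θ₁|} with hE₁
  set E₂ : ∀ n : ℕ, Set (Fin n → ℝ) := fun n => {x | ε₂ ≤ |T.toFun n x - θ₂|} with hE₂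
  have hE₁m : ∀ n, MeasurableSet (E₁ n) := fun n =>
    measurableSet_le measurable_const ((T.measurable_toFun n).sub_const θ₁).abs
  have hE₂m : ∀ n, MeasurableSet (E₂ n) := fun n =>
    measurableSet_le measurable_const ((T.measurable_toFun n).sub_const θ₂).abs
  -- Otherwise the estimate would lie in both open intervals, which are disjoint because ε₁ + ε₂ =
  -- θ₂ - θ₁.
  have hcover : ∀ n, E₁ n ∪ E₂ n = univ := fun n => by
    refine eq_univ_of_forall fun x => ?_
    by_contra h
    have h1 : |T.toFun n x - θ₁| < ε₁ := not_le.mp fun h1 => h (Or.inl h1)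
    have h2 : |T.toFun n x - θ₂| < ε₂ := not_le.mp fun h2 => h (Or.inr h2)
    linarith [(abs_lt.mp h1).2, (abs_lt.mp h2).1]
  have key : ∀ n : ℕ,
      ENNReal.ofReal (Real.exp (-((A₁ + δ) * d))) ^ n
        ≤ 4 * Measure.pi (fun _ : Fin n => densityMeasure (locationFamily f θ₁)) (E₁ n) ∨
      ENNReal.ofReal (Real.exp (-((A₂ + δ) * d))) ^ n
        ≤ 4 * Measure.pi (fun _ : Fin n => densityMeasure (locationFamily f θ₂)) (E₂ n) := by
    intro n
    set ν := Measure.pi (fun _ : Fin n => volume.withDensity (sqrtDensity f θ₁ θ₂)) with hν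
    have hνu : shiftAffinity f (1 / 2) d ^ n ≤ ν (E₁ n) + ν (E₂ n) := by
      refine le_trans (le_of_eq ?_) (measure_union_le _ _)
      rw [hcover, hν, Measure.pi_univ, withDensity_apply _ .univ, Measure.restrict_univ,
        lintegral_sqrtDensity hf, hθ]
      simp
    rcases le_total (ν (E₂ n)) (ν (E₁ n)) with h | h
    · left
      have h1 := pi_sqrtDensity_sq_le hf hS θ₁ θ₂ (hE₁m n)
      rw [hθ] at h1
      refine exp_pow_le_of_affinity ?_ hJ hr (hνu.trans ?_) h1
      · ring
      · rw [two_mul]; gcongr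
    · right
      have h1 := pi_sqrtDensity_sq_le hf hS θ₂ θ₁ (hE₂m n)
      -- With the roles exchanged the shift is -d, so the restricted mass loses the left edge
      -- instead of the right one.
      rw [sqrtDensity_comm, show θ₁ - θ₂ = -d by linarith] at h1
      refine exp_pow_le_of_affinity ?_ hJ hl (hνu.trans ?_) h1
      · ring
      · rw [two_mul]; gcongr
  -- The alternative may depend on n, but one of the two holds for infinitely many n, and that
  -- suffices to bound a lower limit from above.
  exact (frequently_or_distrib.mp (Frequently.of_forall (f := atTop) key)).imp
    liminf_rate_le liminf_rate_le

theorem tendsto_const_mul_nhdsGT_zero {c : ℝ} (hc : 0 < c) :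
    Tendsto (fun ε : ℝ => c * ε) (𝓝[>] 0) (𝓝[>] 0) := by
  refine tendsto_nhdsWithin_of_tendsto_nhds_of_eventually_within _ ?_ ?_
  · have : Tendsto (fun ε : ℝ => c * ε) (𝓝 0) (𝓝 (c * 0)) := tendsto_id.const_mul c
    rw [mul_zero] at this
    exact this.mono_left nhdsWithin_le_nhds
  · filter_upwards [self_mem_nhdsWithin] with ε hε
    exact mul_pos hc hε

/-- The worst case rate of every estimator is bounded by the larger of the two edge slopes. -/
theorem eventually_worstRate_le (hf : IsSmoothPdfOn f S) (hS : IsOpen S)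
    (hS' : S.OrdConnected) (hA : HasEdgeSlopes f S A₁ A₂) (θ : ℝ) {δ : ℝ} (hδ : 0 < δ) :
    ∀ᶠ ε in 𝓝[>] (0 : ℝ), ∀ T : Estimator,
      worstRate (locationFamily f) T θ ε / ((|ε| : ℝ) : EReal)
        ≤ ((2 * max A₁ A₂ + δ : ℝ) : EReal) := by
  filter_upwards [(tendsto_const_mul_nhdsGT_zero two_pos).eventually
    (eventually_errorRate_le_or hf hS hS' hA (half_pos hδ)), self_mem_nhdsWithin] with ε h hε T
  have hε : 0 < ε := hε
  have hε' : (0 : EReal) < ((|ε| : ℝ) : EReal) := by exact_mod_cast abs_pos.mpr hε.ne'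
  rw [EReal.div_le_iff_le_mul hε' (EReal.coe_ne_top _), ← EReal.coe_mul, abs_of_pos hε]
  have h1 := le_max_left A₁ A₂
  have h2 := le_max_right A₁ A₂
  -- Only the two extreme parameters of the window are used, at distance d = 2ε.
  rcases h T (θ - ε) (θ + ε) ε ε (by ring) (by ring) with h | h
  · refine (iInf₂_le (θ - ε) ⟨le_rfl, by linarith⟩).trans (h.trans ?_)
    rw [EReal.coe_le_coe_iff]
    nlinarith
  · refine (iInf₂_le (θ + ε) ⟨by linarith, le_rfl⟩).trans (h.trans ?_)
    rw [EReal.coe_le_coe_iff]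
    nlinarith

/-- The second bound holds for every estimator. -/
theorem alphaTwoOf_le (hf : IsSmoothPdfOn f S) (hS : IsOpen S)
    (hS' : S.OrdConnected) (hA : HasEdgeSlopes f S A₁ A₂) (T : Estimator) (θ : ℝ) :
    alphaTwoOf (fun x => |x|) (locationFamily f) T θ ≤ ((A₁ + A₂ : ℝ) : EReal) := by
  refine EReal.ge_of_forall_gt_iff_ge.mp fun c hc => ?_
  rw [EReal.coe_le_coe_iff]
  by_contra! hlt
  have ha := hA.left_nonneg
  have hb := hA.right_nonneg
  have hev : ∀ᶠ ε in 𝓝[>] (0 : ℝ), ((c * ε : ℝ) : EReal) ≤ worstRate (locationFamily f) T θ ε := by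
    filter_upwards [eventually_lt_of_lt_liminf hc, self_mem_nhdsWithin] with ε h hε
    have hε : 0 < ε := hε
    have hε' : (0 : EReal) < ((|ε| : ℝ) : EReal) := by exact_mod_cast abs_pos.mpr hε.ne'
    have := (EReal.le_div_iff_mul_le hε' (EReal.coe_ne_top _)).mp h.le
    rwa [← EReal.coe_mul, abs_of_pos hε] at this
  -- Half of the excess, so that c = (A₁ + γ) + (A₂ + γ). Splitting d in these proportions gives c *
  -- εᵢ = (Aᵢ + γ) * d, above the bound with γ / 2, and keeps both radii positive even if a slope
  -- vanishes.
  set γ := (c - (A₁ + A₂)) / 2 with hγ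
  have hγ0 : 0 < γ := by rw [hγ]; linarith
  have hc0 : 0 < c := by linarith
  have hp : 0 < (A₁ + γ) / c := by positivity
  have hq : 0 < (A₂ + γ) / c := by positivity
  have hpq : (A₁ + γ) / c + (A₂ + γ) / c = 1 := by
    rw [← add_div, div_eq_one_iff_eq hc0.ne', hγ]; ring
  -- The same `T` is tested at two different radii; this is possible because here the estimator does
  -- not depend on ε.
  obtain ⟨d, ⟨⟨h, h1⟩, h2⟩, hd⟩ := (((eventually_errorRate_le_or hf hS hS' hA (half_pos hγ0)).and
    ((tendsto_const_mul_nhdsGT_zero hp).eventually hev)).and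
    ((tendsto_const_mul_nhdsGT_zero hq).eventually hev)).and self_mem_nhdsWithin |>.exists
  have hd : 0 < d := hd
  set ε₁ := (A₁ + γ) / c * d with hε₁
  set ε₂ := (A₂ + γ) / c * d with hε₂
  have hsum : ε₁ + ε₂ = d := by rw [hε₁, hε₂, ← add_mul, hpq, one_mul]
  have hε₁0 : 0 < ε₁ := mul_pos hp hd
  have hε₂0 : 0 < ε₂ := mul_pos hq hd
  have e1 : c * ε₁ = (A₁ + γ) * d := by rw [hε₁]; field_simp
  have e2 : c * ε₂ = (A₂ + γ) * d := by rw [hε₂]; field_simp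
  rcases h T (θ - ε₁) (θ + ε₂) ε₁ ε₂ (by linarith) hsum with h | h
  · have := h1.trans ((iInf₂_le (θ - ε₁) ⟨le_rfl, by linarith⟩).trans h)
    rw [EReal.coe_le_coe_iff, e1] at this
    nlinarith
  · have := h2.trans ((iInf₂_le (θ + ε₂) ⟨by linarith, le_rfl⟩).trans h)
    rw [EReal.coe_le_coe_iff, e2] at this
    nlinarith

/-! ### Rates of the extreme-value estimators -/

/-- If an error of size `ε` forces all the data into one of two sets, the masses of these sets
bound the error rate below. -/
theorem le_errorRate (hf : IsSmoothPdfOn f S) (hS : IsOpen S) {T : Estimator} {θ ε r : ℝ}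
    {B₁ B₂ : Set ℝ} (hB₁ : MeasurableSet B₁) (hB₂ : MeasurableSet B₂)
    (h₁ : densityMeasure f B₁ ≤ ENNReal.ofReal (Real.exp (-r)))
    (h₂ : densityMeasure f B₂ ≤ ENNReal.ofReal (Real.exp (-r)))
    (h : ∀ n : ℕ, 0 < n → ∀ x : Fin n → ℝ, (∀ i, x i - θ ∈ S) → ε ≤ |T.toFun n x - θ| →
      (∀ i, x i - θ ∈ B₁) ∨ ∀ i, x i - θ ∈ B₂) :
    (r : EReal) ≤ errorRate (locationFamily f) T θ ε := by
  have := hf.isProbabilityMeasure_locationFamily θ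
  refine le_liminf_rate ?_
  filter_upwards [eventually_gt_atTop 0] with n hn
  have hbox : ∀ B : Set ℝ, MeasurableSet B →
      Measure.pi (fun _ : Fin n => densityMeasure (locationFamily f θ))
        (univ.pi fun _ => (fun x => x - θ) ⁻¹' B) = densityMeasure f B ^ n := fun B hB => by
    rw [Measure.pi_pi]
    simp [IsSmoothPdfOn.densityMeasure_locationFamily_apply θ hB]
  have hae : ∀ᵐ x ∂Measure.pi (fun _ : Fin n => densityMeasure (locationFamily f θ)),
      ∀ i, x i - θ ∈ S :=
    eventually_all.mpr fun i =>
      (Measure.tendsto_eval_ae_ae (μ := fun _ : Fin n => densityMeasure (locationFamily f θ))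
        (i := i)).eventually (hf.ae_mem_locationFamily hS θ)
  calc _ ≤ Measure.pi (fun _ : Fin n => densityMeasure (locationFamily f θ))
        ((univ.pi fun _ => (fun x => x - θ) ⁻¹' B₁) ∪
          univ.pi fun _ => (fun x => x - θ) ⁻¹' B₂) := by
        refine measure_mono_ae ?_
        filter_upwards [hae] with x hx hxE
        exact (h n hn x hx hxE).imp (fun h i _ => h i) fun h i _ => h i
    _ ≤ densityMeasure f B₁ ^ n + densityMeasure f B₂ ^ n := by
        rw [← hbox B₁ hB₁, ← hbox B₂ hB₂]
        exact measure_union_le _ _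
    _ ≤ _ := by rw [two_mul]; gcongr

/-- The mass of the points at distance at least `ε / l` from the left end point. -/
theorem eventually_densityMeasure_far_left (hf : IsSmoothPdfOn f S) {a l c δ : ℝ}
    (hA : Tendsto f (𝓝[>] a) (𝓝 A₁)) (hl : 0 ≤ l) (hlc : l * c = A₁) (hδ : 0 < δ) :
    ∀ᶠ ε in 𝓝[>] (0 : ℝ), densityMeasure f {y | ε ≤ l * (y - a)}
      ≤ ENNReal.ofReal (Real.exp (-((c - δ) * ε))) := by
  have := hf.isProbabilityMeasure_densityMeasure
  rcases hl.eq_or_lt with rfl | hl0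
  -- With weight 0 the set is empty, since ε > 0; any c is then allowed.
  · filter_upwards [self_mem_nhdsWithin] with ε hε
    have : {y | ε ≤ 0 * (y - a)} = ∅ := eq_empty_of_forall_notMem fun y hy => by
      have hy : ε ≤ 0 * (y - a) := hy
      rw [zero_mul] at hy
      exact hy.not_gt hε
    rw [this, measure_empty]
    exact zero_le
  -- The strip has width ε / l, so tolerance l * δ on the slope gives exponent (A₁ - lδ)ε/l = (c -
  -- δ)ε.
  · filter_upwards [(tendsto_const_mul_nhdsGT_zero (inv_pos.mpr hl0)).eventually
      (eventually_densityMeasure_left hA (mul_pos hl0 hδ))] with ε hε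
    refine (measure_le_one_sub measurableSet_Ioo (.of_forall fun y hy hyB => ?_) hε.1).trans
      (ENNReal.ofReal_le_ofReal ((one_sub_mul_le_exp _ _).trans_eq ?_))
    · have hy : ε ≤ l * (y - a) := hy
      have h1 : y - a < l⁻¹ * ε := by linarith [hyB.2]
      rw [inv_mul_eq_div, lt_div_iff₀ hl0] at h1
      linarith
    · rw [← hlc]
      congr 1
      field_simp

/-- The mass of the points at distance at least `ε / l` from the right end point. -/
theorem eventually_densityMeasure_far_right (hf : IsSmoothPdfOn f S) {b l c δ : ℝ}
    (hA : Tendsto f (𝓝[<] b) (𝓝 A₂)) (hl : 0 ≤ l) (hlc : l * c = A₂) (hδ : 0 < δ) :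
    ∀ᶠ ε in 𝓝[>] (0 : ℝ), densityMeasure f {y | ε ≤ l * (b - y)}
      ≤ ENNReal.ofReal (Real.exp (-((c - δ) * ε))) := by
  have := hf.isProbabilityMeasure_densityMeasure
  rcases hl.eq_or_lt with rfl | hl0
  · filter_upwards [self_mem_nhdsWithin] with ε hε
    have : {y | ε ≤ 0 * (b - y)} = ∅ := eq_empty_of_forall_notMem fun y hy => by
      have hy : ε ≤ 0 * (b - y) := hy
      rw [zero_mul] at hy
      exact hy.not_gt hε
    rw [this, measure_empty]
    exact zero_le
  · filter_upwards [(tendsto_const_mul_nhdsGT_zero (inv_pos.mpr hl0)).eventually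
      (eventually_densityMeasure_right hA (mul_pos hl0 hδ))] with ε hε
    refine (measure_le_one_sub measurableSet_Ioo (.of_forall fun y hy hyB => ?_) hε.1).trans
      (ENNReal.ofReal_le_ofReal ((one_sub_mul_le_exp _ _).trans_eq ?_))
    · have hy : ε ≤ l * (b - y) := hy
      have h1 : b - y < l⁻¹ * ε := by linarith [hyB.1]
      rw [inv_mul_eq_div, lt_div_iff₀ hl0] at h1
      linarith
    · rw [← hlc]
      congr 1
      field_simp

theorem le_worstRate_div {p : ℝ → ℝ → ℝ} {T : Estimator} {θ ε c : ℝ} (hε : 0 < ε)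
    (h : ∀ θ', ((c * ε : ℝ) : EReal) ≤ errorRate p T θ' ε) :
    (c : EReal) ≤ worstRate p T θ ε / ((|ε| : ℝ) : EReal) := by
  have hε' : (0 : EReal) < ((|ε| : ℝ) : EReal) := by exact_mod_cast abs_pos.mpr hε.ne'
  rw [EReal.le_div_iff_mul_le hε' (EReal.coe_ne_top _), ← EReal.coe_mul, abs_of_pos hε]
  exact le_iInf₂ fun θ' _ => h θ'

theorem measurableSet_far_left (a l ε : ℝ) : MeasurableSet {y : ℝ | ε ≤ l * (y - a)} :=
  measurableSet_le measurable_const ((measurable_id.sub_const a).const_mul l)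

theorem measurableSet_far_right (b l ε : ℝ) : MeasurableSet {y : ℝ | ε ≤ l * (b - y)} :=
  measurableSet_le measurable_const ((measurable_id.const_sub b).const_mul l)

/-- The rate of `min_i x_i - a - ε`. -/
theorem eventually_le_worstRate_minEstimator_add (hf : IsSmoothPdfOn f S) (hS : IsOpen S)
    {a : ℝ} (hSa : S ⊆ Ioi a) (hA : Tendsto f (𝓝[>] a) (𝓝 A₁)) (θ : ℝ) {δ : ℝ} (hδ : 0 < δ) :
    ∀ᶠ ε in 𝓝[>] (0 : ℝ), ((2 * A₁ - δ : ℝ) : EReal)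
      ≤ worstRate (locationFamily f) (minEstimator (a + ε)) θ ε / ((|ε| : ℝ) : EReal) := by
  filter_upwards [eventually_densityMeasure_far_left hf hA (l := 1 / 2) (c := 2 * A₁)
    (by norm_num) (by ring) hδ, self_mem_nhdsWithin] with ε h hε
  refine le_worstRate_div hε fun θ' => le_errorRate hf hS (measurableSet_far_left _ _ _)
    (measurableSet_far_left _ _ _) h h fun n hn x hx he => ?_
  have : Nonempty (Fin n) := ⟨⟨0, hn⟩⟩
  -- The minimum is attained, hence strictly above a + θ'. This excludes a negative error of size
  -- exactly ε, so an error means that the minimum is at least 2ε above the end point: hence the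
  -- weight 1/2.
  obtain ⟨j, hj⟩ := exists_eq_ciInf_of_finite (f := x)
  have hmin : ∀ i, (⨅ i, x i) ≤ x i := fun i => ciInf_le (finite_range x).bddBelow i
  have h0 : a < x j - θ' := hSa (hx j)
  have he : ε ≤ |(⨅ i, x i) - (a + ε) - θ'| := he
  refine Or.inl fun i => ?_
  change ε ≤ 1 / 2 * (x i - θ' - a)
  rcases le_abs.mp he with h1 | h1 <;> linarith [hmin i]

/-- The rate of `max_i x_i - b + ε`. -/
theorem eventually_le_worstRate_maxEstimator_sub (hf : IsSmoothPdfOn f S) (hS : IsOpen S)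
    {b : ℝ} (hSb : S ⊆ Iio b) (hA : Tendsto f (𝓝[<] b) (𝓝 A₂)) (θ : ℝ) {δ : ℝ} (hδ : 0 < δ) :
    ∀ᶠ ε in 𝓝[>] (0 : ℝ), ((2 * A₂ - δ : ℝ) : EReal)
      ≤ worstRate (locationFamily f) (maxEstimator (b - ε)) θ ε / ((|ε| : ℝ) : EReal) := by
  filter_upwards [eventually_densityMeasure_far_right hf hA (l := 1 / 2) (c := 2 * A₂)
    (by norm_num) (by ring) hδ, self_mem_nhdsWithin] with ε h hε
  refine le_worstRate_div hε fun θ' => le_errorRate hf hS (measurableSet_far_right _ _ _)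
    (measurableSet_far_right _ _ _) h h fun n hn x hx he => ?_
  have : Nonempty (Fin n) := ⟨⟨0, hn⟩⟩
  obtain ⟨j, hj⟩ := exists_eq_ciSup_of_finite (f := x)
  have hmax : ∀ i, x i ≤ ⨆ i, x i := fun i => le_ciSup (finite_range x).bddAbove i
  have h0 : x j - θ' < b := hSb (hx j)
  have he : ε ≤ |(⨆ i, x i) - (b - ε) - θ'| := he
  refine Or.inl fun i => ?_
  change ε ≤ 1 / 2 * (b - (x i - θ'))
  rcases le_abs.mp he with h1 | h1 <;> linarith [hmax i]

theorem le_alphaTwoOf_of_eventually {p : ℝ → ℝ → ℝ} {T : Estimator} {θ c : ℝ}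
    (h : ∀ δ : ℝ, 0 < δ → ∀ᶠ ε in 𝓝[>] (0 : ℝ),
      ((c - δ : ℝ) : EReal) ≤ worstRate p T θ ε / ((|ε| : ℝ) : EReal)) :
    (c : EReal) ≤ alphaTwoOf (fun x => |x|) p T θ := by
  refine EReal.ge_of_forall_gt_iff_ge.mp fun z hz => ?_
  have hz : z < c := by exact_mod_cast hz
  refine le_liminf_of_le (by isBoundedDefault) ?_
  have := h (c - z) (sub_pos.mpr hz)
  rwa [sub_sub_cancel] at this

/-- The rate of `min_i x_i - a`. -/
theorem le_alphaTwoOf_minEstimator (hf : IsSmoothPdfOn f S) (hS : IsOpen S)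
    {a : ℝ} (hSa : S ⊆ Ioi a) (hA : Tendsto f (𝓝[>] a) (𝓝 A₁)) (θ : ℝ) :
    (A₁ : EReal) ≤ alphaTwoOf (fun x => |x|) (locationFamily f) (minEstimator a) θ := by
  refine le_alphaTwoOf_of_eventually fun δ hδ => ?_
  filter_upwards [eventually_densityMeasure_far_left hf hA (l := 1) (c := A₁)
    (by norm_num) (by ring) hδ, self_mem_nhdsWithin] with ε h hε
  have hε0 : 0 < ε := hε
  refine le_worstRate_div hε fun θ' => le_errorRate hf hS (measurableSet_far_left _ _ _)
    (measurableSet_far_left _ _ _) h h fun n hn x hx he => ?_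
  have : Nonempty (Fin n) := ⟨⟨0, hn⟩⟩
  obtain ⟨j, hj⟩ := exists_eq_ciInf_of_finite (f := x)
  have hmin : ∀ i, (⨅ i, x i) ≤ x i := fun i => ciInf_le (finite_range x).bddBelow i
  have h0 : a < x j - θ' := hSa (hx j)
  have he : ε ≤ |(⨅ i, x i) - a - θ'| := he
  refine Or.inl fun i => ?_
  change ε ≤ 1 * (x i - θ' - a)
  rcases le_abs.mp he with h1 | h1 <;> linarith [hmin i]

/-- The rate of a convex combination of `min_i x_i - a` and `max_i x_i - b`. -/
theorem le_alphaTwoOf_convexEstimator {a b : ℝ} (hf : IsSmoothPdfOn f (Ioo a b))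
    (hA₁ : Tendsto f (𝓝[>] a) (𝓝 A₁)) (hA₂ : Tendsto f (𝓝[<] b) (𝓝 A₂)) (θ : ℝ) {l : ℝ}
    (hl : l ∈ Icc (0 : ℝ) 1) (hlA : l * (A₁ + A₂) = A₁) :
    ((A₁ + A₂ : ℝ) : EReal)
      ≤ alphaTwoOf (fun x => |x|) (locationFamily f) (convexEstimator a b l) θ := by
  refine le_alphaTwoOf_of_eventually fun δ hδ => ?_
  filter_upwards [eventually_densityMeasure_far_left hf hA₁ hl.1 hlA hδ,
    eventually_densityMeasure_far_right hf hA₂ (l := 1 - l) (c := A₁ + A₂)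
      (sub_nonneg.mpr hl.2) (by linarith) hδ, self_mem_nhdsWithin] with ε h1 h2 hε
  refine le_worstRate_div hε fun θ' => le_errorRate hf isOpen_Ioo (measurableSet_far_left _ _ _)
    (measurableSet_far_right _ _ _) h1 h2 fun n hn x hx he => ?_
  have : Nonempty (Fin n) := ⟨⟨0, hn⟩⟩
  obtain ⟨j, hj⟩ := exists_eq_ciInf_of_finite (f := x)
  obtain ⟨k, hk⟩ := exists_eq_ciSup_of_finite (f := x)
  have hmin : ∀ i, (⨅ i, x i) ≤ x i := fun i => ciInf_le (finite_range x).bddBelow i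
  have hmax : ∀ i, x i ≤ ⨆ i, x i := fun i => le_ciSup (finite_range x).bddAbove i
  have h0 : a < x j - θ' := (hx j).1
  have h0' : x k - θ' < b := (hx k).2
  have he : ε ≤ |l * ((⨅ i, x i) - a) + (1 - l) * ((⨆ i, x i) - b) - θ'| := he
  have hl1 : 0 ≤ 1 - l := sub_nonneg.mpr hl.2
  -- The error is the difference of the nonnegative terms in `p1` and `p2`, so a deviation of ε
  -- makes one of them at least ε, and then so is the corresponding term for every observation.
  have p1 : 0 ≤ l * ((⨅ i, x i) - θ' - a) := mul_nonneg hl.1 (by linarith)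
  have p2 : 0 ≤ (1 - l) * (b - ((⨆ i, x i) - θ')) := mul_nonneg hl1 (by linarith)
  rcases le_abs.mp he with h | h
  · refine Or.inl fun i => ?_
    change ε ≤ l * (x i - θ' - a)
    have : l * ((⨅ i, x i) - θ' - a) ≤ l * (x i - θ' - a) :=
      mul_le_mul_of_nonneg_left (by linarith [hmin i]) hl.1
    linarith
  · refine Or.inr fun i => ?_
    change ε ≤ (1 - l) * (b - (x i - θ'))
    have : (1 - l) * (b - ((⨆ i, x i) - θ')) ≤ (1 - l) * (b - (x i - θ')) :=
      mul_le_mul_of_nonneg_left (by linarith [hmax i]) hl1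
    linarith

/-! ### Evaluation of the bounds and conclusion -/

theorem isScalingExponent_abs : IsScalingExponent (fun x => |x|) 1 := by
  intro x hx
  rw [Real.rpow_one]
  refine tendsto_const_nhds.congr' ?_
  filter_upwards [self_mem_nhdsWithin] with ε hε
  have hε : 0 < ε := hε
  rw [abs_of_pos hε, abs_of_pos (mul_pos hx hε), mul_div_cancel_right₀ _ hε.ne']

theorem iSup_weighted_eq_max (A₁ A₂ : ℝ) :
    ⨆ s ∈ Ioo (0 : ℝ) 1, ((A₁ * s + A₂ * (1 - s) : ℝ) : EReal) = ((max A₁ A₂ : ℝ) : EReal) := by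
  have hcont : Continuous fun s : ℝ => ((A₁ * s + A₂ * (1 - s) : ℝ) : EReal) :=
    continuous_coe_real_ereal.comp (by fun_prop)
  refine le_antisymm (iSup₂_le fun s hs => ?_) ?_
  · rw [EReal.coe_le_coe_iff]
    nlinarith [le_max_left A₁ A₂, le_max_right A₁ A₂, hs.1, hs.2]
  -- The larger slope is the value at s = 1 or s = 0, outside the open interval, and is recovered by
  -- continuity.
  · rcases le_total A₂ A₁ with h | h
    · rw [max_eq_left h]
      have ht := (hcont.tendsto 1).mono_left (nhdsWithin_le_nhds (s := Iio 1))
      rw [mul_one, sub_self, mul_zero, add_zero] at ht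
      refine le_of_tendsto ht ?_
      filter_upwards [Ioo_mem_nhdsLT one_pos] with s hs
      exact le_iSup₂ (f := fun (s : ℝ) (_ : s ∈ Ioo (0 : ℝ) 1) =>
        ((A₁ * s + A₂ * (1 - s) : ℝ) : EReal)) s hs
    · rw [max_eq_right h]
      have ht := (hcont.tendsto 0).mono_left (nhdsWithin_le_nhds (s := Ioi 0))
      rw [mul_zero, sub_zero, mul_one, zero_add] at ht
      refine le_of_tendsto ht ?_
      filter_upwards [Ioo_mem_nhdsGT one_pos] with s hs
      exact le_iSup₂ (f := fun (s : ℝ) (_ : s ∈ Ioo (0 : ℝ) 1) =>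
        ((A₁ * s + A₂ * (1 - s) : ℝ) : EReal)) s hs

end NonregularEstimation

theorem mainTheorem6 (f : ℝ → ℝ) (a b A₁ A₂ : ℝ) (S : Set ℝ)
    (hf : IsSmoothPdfOn f S)
    (hA₁ : Tendsto f (𝓝[>] a) (𝓝 A₁))
    -- the support is a bounded interval, or a half line, where `A₂ = 0`
    (hS : (a < b ∧ S = Ioo a b ∧ Tendsto f (𝓝[<] b) (𝓝 A₂)) ∨ (S = Ioi a ∧ A₂ = 0))
    (g : ℝ → ℝ) (hg : g = fun x => |x|) (θ : ℝ) :
    -- `κ = 1`, and `I^s_{g,θ}` is a limit that is uniform in `0 < s < 1`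
    IsScalingExponent g 1 ∧
    (∀ δ : ℝ, 0 < δ → ∀ᶠ ε in 𝓝[>] (0 : ℝ), ∀ s ∈ Ioo (0 : ℝ) 1,
      ((A₁ * s + A₂ * (1 - s) - δ : ℝ) : EReal) ≤ renyiQuotient g (locationFamily f) θ s ε ∧
      renyiQuotient g (locationFamily f) θ s ε ≤ ((A₁ * s + A₂ * (1 - s) + δ : ℝ) : EReal)) ∧
    (∀ s ∈ Ioo (0 : ℝ) 1,
      renyiLimit g (locationFamily f) θ s = ((A₁ * s + A₂ * (1 - s) : ℝ) : EReal)) ∧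
    -- the first bound
    alphaOne g (locationFamily f) θ = alphaBarOne g 1 (locationFamily f) θ ∧
    alphaBarOne g 1 (locationFamily f) θ
      = 2 * ⨆ s ∈ Ioo (0 : ℝ) 1, renyiLimit g (locationFamily f) θ s ∧
    alphaBarOne g 1 (locationFamily f) θ = ((2 * max A₁ A₂ : ℝ) : EReal) ∧
    -- the second bound
    alphaTwo g (locationFamily f) θ = alphaBarTwo g 1 (locationFamily f) θ ∧
    alphaBarTwo g 1 (locationFamily f) θ = 2 * renyiLimit g (locationFamily f) θ (1 / 2) ∧
    alphaBarTwo g 1 (locationFamily f) θ = ((A₁ + A₂ : ℝ) : EReal) ∧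
    -- coincidence
    (alphaOne g (locationFamily f) θ = alphaTwo g (locationFamily f) θ ↔ A₁ = A₂) ∧
    -- the first bound is attained by `min_i x_i - a - ε` or by `max_i x_i - b + ε`
    (A₂ ≤ A₁ →
      Tendsto (fun ε : ℝ =>
          worstRate (locationFamily f) (minEstimator (a + ε)) θ ε / ((g ε : ℝ) : EReal))
        (𝓝[>] 0) (𝓝 ((2 * max A₁ A₂ : ℝ) : EReal))) ∧
    (S = Ioo a b → A₁ ≤ A₂ →
      Tendsto (fun ε : ℝ =>
          worstRate (locationFamily f) (maxEstimator (b - ε)) θ ε / ((g ε : ℝ) : EReal))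
        (𝓝[>] 0) (𝓝 ((2 * max A₁ A₂ : ℝ) : EReal))) ∧
    -- the second bound is attained by `l (min_i x_i - a) + (1 - l) (max_i x_i - b)` with
    -- `l = A₁ / (A₁ + A₂)`, and on a half line by `min_i x_i - a`
    (S = Ioo a b → ∀ l ∈ Icc (0 : ℝ) 1, l * (A₁ + A₂) = A₁ →
      alphaTwoOf g (locationFamily f) (convexEstimator a b l) θ = ((A₁ + A₂ : ℝ) : EReal)) ∧
    (S = Ioi a →
      alphaTwoOf g (locationFamily f) (minEstimator a) θ = ((A₁ + A₂ : ℝ) : EReal)) := by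
  subst hg
  have hSo : IsOpen S := by
    rcases hS with ⟨-, rfl, -⟩ | ⟨rfl, -⟩
    exacts [isOpen_Ioo, isOpen_Ioi]
  have hSc : S.OrdConnected := by
    rcases hS with ⟨-, rfl, -⟩ | ⟨rfl, -⟩
    exacts [ordConnected_Ioo, ordConnected_Ioi]
  have hSa : S ⊆ Ioi a := by
    rcases hS with ⟨-, rfl, -⟩ | ⟨rfl, -⟩
    exacts [Ioo_subset_Ioi_self, subset_rfl]
  have hA : HasEdgeSlopes f S A₁ A₂ := by
    rcases hS with ⟨-, rfl, hA₂⟩ | ⟨rfl, rfl⟩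
    exacts [hf.hasEdgeSlopes_Ioo hA₁ hA₂, hf.hasEdgeSlopes_Ioi hA₁]
  have hA₂ : S = Ioo a b → Tendsto f (𝓝[<] b) (𝓝 A₂) := fun h => by
    rcases hS with ⟨-, -, hA₂⟩ | ⟨h', -⟩
    · exact hA₂
    · exact absurd (h'.symm.trans h ▸ bddAbove_Ioo : BddAbove (Ioi a)) (not_bddAbove_Ioi a)
  have hA₂' : S = Ioi a → A₂ = 0 := fun h => by
    rcases hS with ⟨-, h', -⟩ | ⟨-, h'⟩
    · exact absurd (h.symm.trans h' ▸ bddAbove_Ioo : BddAbove (Ioi a)) (not_bddAbove_Ioi a)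
    · exact h'
  have hlim : ∀ s ∈ Ioo (0 : ℝ) 1, renyiLimit (fun x => |x|) (locationFamily f) θ s
      = ((A₁ * s + A₂ * (1 - s) : ℝ) : EReal) := fun s hs => renyiLimit_eq hf hSo hSc hA θ hs
  have hmin : A₂ ≤ A₁ → Tendsto (fun ε : ℝ =>
      worstRate (locationFamily f) (minEstimator (a + ε)) θ ε / ((|ε| : ℝ) : EReal))
      (𝓝[>] 0) (𝓝 ((2 * max A₁ A₂ : ℝ) : EReal)) := fun h =>
    tendsto_coe_of_eventually_mem fun δ hδ =>
      (max_eq_left h ▸ eventually_le_worstRate_minEstimator_add hf hSo hSa hA₁ θ hδ).and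
        ((eventually_worstRate_le hf hSo hSc hA θ hδ).mono fun _ h => h _)
  have hmax : S = Ioo a b → A₁ ≤ A₂ → Tendsto (fun ε : ℝ =>
      worstRate (locationFamily f) (maxEstimator (b - ε)) θ ε / ((|ε| : ℝ) : EReal))
      (𝓝[>] 0) (𝓝 ((2 * max A₁ A₂ : ℝ) : EReal)) := fun hSb h =>
    tendsto_coe_of_eventually_mem fun δ hδ =>
      (max_eq_right h ▸ eventually_le_worstRate_maxEstimator_sub hf hSo
        (hSb ▸ Ioo_subset_Iio_self) (hA₂ hSb) θ hδ).and
        ((eventually_worstRate_le hf hSo hSc hA θ hδ).mono fun _ h => h _)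
  have hconv : S = Ioo a b → ∀ l ∈ Icc (0 : ℝ) 1, l * (A₁ + A₂) = A₁ →
      alphaTwoOf (fun x => |x|) (locationFamily f) (convexEstimator a b l) θ
        = ((A₁ + A₂ : ℝ) : EReal) := fun hSb l hl hlA =>
    (alphaTwoOf_le hf hSo hSc hA _ θ).antisymm
      (le_alphaTwoOf_convexEstimator (hSb ▸ hf) hA₁ (hA₂ hSb) θ hl hlA)
  have hhalf : S = Ioi a → alphaTwoOf (fun x => |x|) (locationFamily f) (minEstimator a) θ
      = ((A₁ + A₂ : ℝ) : EReal) := fun hSb =>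
    (alphaTwoOf_le hf hSo hSc hA _ θ).antisymm (by
      rw [hA₂' hSb, add_zero]
      exact le_alphaTwoOf_minEstimator hf hSo hSa hA₁ θ)
  have hone : alphaOne (fun x => |x|) (locationFamily f) θ = ((2 * max A₁ A₂ : ℝ) : EReal) := by
    -- some sequence of estimators attains the bound
    obtain ⟨T, hT⟩ : ∃ T : ℝ → Estimator, Tendsto (fun ε : ℝ =>
        worstRate (locationFamily f) (T ε) θ ε / ((|ε| : ℝ) : EReal))
        (𝓝[>] 0) (𝓝 ((2 * max A₁ A₂ : ℝ) : EReal)) := by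
      rcases le_total A₂ A₁ with h | h
      · exact ⟨_, hmin h⟩
      · rcases hS with ⟨-, hSb, -⟩ | ⟨-, h2⟩
        · exact ⟨_, hmax hSb h⟩
        -- On a half line A₂ = 0 ≤ A₁, so the minimum serves in this case as well.
        · exact ⟨_, hmin (h2.trans_le hA.left_nonneg)⟩
    refine le_antisymm ?_ ?_
    · refine EReal.le_of_forall_lt_iff_le.mp fun z hz => ?_
      have hz : 2 * max A₁ A₂ < z := by exact_mod_cast hz
      refine limsup_le_of_le (by isBoundedDefault) ?_
      filter_upwards [eventually_worstRate_le hf hSo hSc hA θ (sub_pos.mpr hz),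
        self_mem_nhdsWithin] with ε h hε
      have hε : 0 < ε := hε
      have hε' : (0 : EReal) < ((|ε| : ℝ) : EReal) := by exact_mod_cast abs_pos.mpr hε.ne'
      rw [add_sub_cancel] at h
      rw [EReal.div_le_iff_le_mul hε' (EReal.coe_ne_top _)]
      exact iSup_le fun T => (EReal.div_le_iff_le_mul hε' (EReal.coe_ne_top _)).mp (h T)
    · rw [← hT.limsup_eq]
      refine limsup_le_limsup (.of_forall fun ε => ?_) (by isBoundedDefault) (by isBoundedDefault)
      exact EReal.div_le_div_right_of_nonneg (by exact_mod_cast abs_nonneg ε)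
        (le_iSup (fun T => worstRate (locationFamily f) T θ ε) (T ε))
  have htwo : alphaTwo (fun x => |x|) (locationFamily f) θ = ((A₁ + A₂ : ℝ) : EReal) := by
    refine le_antisymm (iSup_le fun T => alphaTwoOf_le hf hSo hSc hA T θ) ?_
    rcases hS with ⟨-, hSb, -⟩ | ⟨hSb, -⟩
    · have ha := hA.left_nonneg
      have hb := hA.right_nonneg
      -- If A₁ + A₂ = 0 both slopes vanish and every weight satisfies l * (A₁ + A₂) = A₁; the weight
      -- 0 is taken.
      rcases (add_nonneg ha hb).eq_or_lt with h | h
      · exact (hconv hSb 0 (by norm_num) (by linarith)).symm.trans_le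
          (le_iSup (fun T => alphaTwoOf (fun x => |x|) (locationFamily f) T θ) _)
      · refine (hconv hSb (A₁ / (A₁ + A₂)) ⟨by positivity, ?_⟩ ?_).symm.trans_le
          (le_iSup (fun T => alphaTwoOf (fun x => |x|) (locationFamily f) T θ) _)
        · exact (div_le_one h).mpr (by linarith)
        · exact div_mul_cancel₀ _ h.ne'
    · exact (hhalf hSb).symm.trans_le
        (le_iSup (fun T => alphaTwoOf (fun x => |x|) (locationFamily f) T θ) _)
  have hsup : ⨆ s ∈ Ioo (0 : ℝ) 1, renyiLimit (fun x => |x|) (locationFamily f) θ s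
      = ((max A₁ A₂ : ℝ) : EReal) := by
    rw [← iSup_weighted_eq_max]
    exact iSup_congr fun s => iSup_congr (hlim s)
  have hbar1 : alphaBarOne (fun x => |x|) 1 (locationFamily f) θ
      = 2 * ⨆ s ∈ Ioo (0 : ℝ) 1, renyiLimit (fun x => |x|) (locationFamily f) θ s := by
    rw [alphaBarOne, Real.rpow_one]
    rfl
  have hbar1' : alphaBarOne (fun x => |x|) 1 (locationFamily f) θ
      = ((2 * max A₁ A₂ : ℝ) : EReal) := by
    rw [hbar1, hsup, EReal.coe_mul]
    rfl
  have hbar2 : alphaBarTwo (fun x => |x|) 1 (locationFamily f) θ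
      = 2 * renyiLimit (fun x => |x|) (locationFamily f) θ (1 / 2) := by
    rw [alphaBarTwo, if_neg (lt_irrefl _), if_pos rfl]
  have hbar2' : alphaBarTwo (fun x => |x|) 1 (locationFamily f) θ
      = ((A₁ + A₂ : ℝ) : EReal) := by
    rw [hbar2, hlim _ (by norm_num), show (A₁ + A₂ : ℝ) = 2 * (A₁ * (1 / 2) + A₂ * (1 - 1 / 2)) by
      ring, EReal.coe_mul]
    rfl
  refine ⟨isScalingExponent_abs, fun δ hδ => eventually_renyiQuotient hf hSo hSc hA θ hδ, hlim,
    hone.trans hbar1'.symm, hbar1, hbar1', htwo.trans hbar2'.symm, hbar2, hbar2', ?_, hmin, hmax,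
    hconv, hhalf⟩
  rw [hone, htwo, EReal.coe_eq_coe_iff]
  constructor
  · intro h
    rcases le_total A₁ A₂ with h' | h'
    · rw [max_eq_right h'] at h; linarith
    · rw [max_eq_left h'] at h; linarith
  · rintro rfl
    rw [max_self]; ring
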